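/- Let $Y$ be a simply connected, 1-ended, locally finite CW complex of dimension at most 2, and let $J$ be an infinite finitely generated group acting on $Y$ by covering transformations that permute the open cells. Fix a vertex $\ast$ of $Y$. An edge path is a finite sequence of edges (1-cells), consecutive ones sharing a vertex; its length is the number of its edges. An edge path ray is an infinite such sequence, and it is proper if every compact set meets only finitely many of its edges (counted with multiplicity). For $K\subseteq Y$ put $J\cdot K=\bigcup_{j\in J}jK$. A subset of $Y$ is $J$-bounded if it lies in $J\cdot K$ for some compact $K$, and $J$-unbounded otherwise. Let $C$ be a finite subcomplex of $Y$ and let $U$ be a $J$-unbounded connected component of $Y-J\cdot C$ such that any two vertices of $Y$ lying in $U$ are joined by an edge path in $U$. Let $S=\{j\in J: jU=U\}$, let $S^0$ be a finite generating set of $S$, and let $\Lambda=\Lambda(S,S^0)$ be the Cayley graph. Let $m:\Lambda\to Y$ be an $S$-equivariant map with $m(s)=s\ast$ for each $s\in S$, which maps each edge of $\Lambda$ to an edge path of $Y$. Let $\mathcal E(\Lambda)$ be the set of ends of $\Lambda$, that is, of equivalence classes of proper edge path rays, two rays being equivalent if for every compact set $F$ some edge path in $\Lambda-F$ joins a vertex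 of one to a vertex of the other. For a compact set $E\supseteq C$ let $\mathcal E(U,E)$ be the set of equivalence classes of ($J$-bounded) proper edge path rays in $U\cap(J\cdot E)$, where $r$ and $s$ are equivalent if for every compact $F\subseteq Y$ there is an edge path in $(U\cap(J\cdot E))-F$ from a vertex of $r$ to a vertex of $s$. For $D\subseteq E$ the inclusion induces a map $\iota_E:\mathcal E(U,D)\to\mathcal E(U,E)$. Then there are a compact set $D\supseteq C$ in $Y$, a bijection $\mathcal M:\mathcal E(\Lambda)\to\mathcal E(U,D)$ and an integer $I$ such that for every compact set $E\supseteq D$ the following hold. 1. The map $\iota_E$ is injective. If $E$ is a connected finite subcomplex of $Y$, then $\iota_E$ is a bijection, so that $\mathcal M_E=\iota_E\circ\mathcal M:\mathcal E(\Lambda)\to\mathcal E(U,E)=\mathcal E(U,D)$ is a bijection. 2. If $q$ is a proper edge path ray in $\Lambda$ and $\iota_E(\mathcal M([q]))=[t]$ in $\mathcal E(U,E)$, then there is $t'\in[t]$ such that each vertex of $m(q)$ is joined by an edge path in $Y$ of length at most $I$ to a vertex of $t'$, and each vertex of $t'$ is joined by an edge path in $Y$ of length at most $I$ to a vertex of $m(q)$.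 -/

import Mathlib

open Set Topology
open scoped Pointwise

namespace JEnd

universe u v w

/-! ### Edge paths and edge path rays in a multigraph -/

/-- `IsEdgePath G x p y`: the list `p = [(e₁, x₁), …, (eₙ, xₙ)]` is an edge path in `G` from `x` to
`y`, that is `x₀ = x`, the edge `eᵢ` has ends `xᵢ₋₁` and `xᵢ`, and `xₙ = y`.
Its length is the length of the list. -/
def IsEdgePath {V : Type u} {E : Type v} (G : Graph V E) : V → List (E × V) → V → Prop
  | x, [], y => x = y
  | x, d :: p, y => G.IsLink d.1 x d.2 ∧ IsEdgePath G d.2 p y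

/-- An edge path ray: an infinite sequence of edges, consecutive ones sharing the indicated
vertex. -/
structure EdgeRay {V : Type u} {E : Type v} (G : Graph V E) where
  vert : ℕ → V
  edge : ℕ → E
  link : ∀ k, G.IsLink (edge k) (vert k) (vert (k + 1))

/-! ### The Cayley graph and its ends -/

section Cayley

variable {G : Type u} [Group G]

/-- The Cayley graph of `G` with respect to `A`: the vertices are the elements of `G`, and for all
`g : G` and `a ∈ A` there is one edge `(g, a)`, joining `g` and `g * a`. The group `G` acts on it
by left multiplication. -/
def cayleyGraph (A : Set G) : Graph G (G × A) where
  vertexSet := univ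
  IsLink e x y := (x = e.1 ∧ y = e.1 * e.2) ∨ (x = e.1 * e.2 ∧ y = e.1)
  isLink_symm := by
    intro e _
    exact ⟨fun x y h => by tauto⟩
  eq_or_eq_of_isLink_of_isLink := by
    rintro e x y z w (⟨rfl, rfl⟩ | ⟨rfl, rfl⟩) (⟨rfl, rfl⟩ | ⟨rfl, rfl⟩) <;> simp
  left_mem_of_isLink := fun _ _ _ _ => mem_univ _

/-- Proper edge path rays of the Cayley graph for a finite set `A`: as this graph is locally finite,
a ray is proper if and only if it visits every vertex finitely often. -/
def CayleyRay (A : Set G) : Type u :=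
  {q : EdgeRay (cayleyGraph A) // ∀ x : G, {k | q.vert k = x}.Finite}

/-- Two proper rays of the Cayley graph are equivalent if outside any finite set `F` of vertices
there is an edge path from a vertex of the first to a vertex of the second. -/
def CayleyRay.Equiv {A : Set G} (q r : CayleyRay A) : Prop :=
  ∀ F : Set G, F.Finite → ∃ (i j : ℕ) (p : List ((G × A) × G)),
    IsEdgePath (cayleyGraph A) (q.1.vert i) p (r.1.vert j) ∧
      q.1.vert i ∉ F ∧ ∀ d ∈ p, d.2 ∉ F

/-- The set of ends of the Cayley graph: the classes of proper edge path rays. (The relation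
`CayleyRay.Equiv` is an equivalence relation.) -/
def CayleyEnds (A : Set G) : Type u := Quot (CayleyRay.Equiv (A := A))

end Cayley

/-! ### CW complexes -/

section Complex

variable (Y : Type u) [TopologicalSpace Y]

/-- One-ended: the complement of any compact set has exactly one component which is not contained
in a compact set. -/
def OneEnded : Prop :=
  ∀ K : Set Y, IsCompact K →
    ∃! W : Set Y, (∃ x ∈ Kᶜ, W = connectedComponentIn Kᶜ x) ∧ ¬ ∃ L, IsCompact L ∧ W ⊆ L

variable [CWComplex (univ : Set Y)]

/-- Each point has a neighbourhood meeting only finitely many closed cells. -/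
def LocallyFiniteCW : Prop :=
  LocallyFinite fun c : Σ n, RelCWComplex.cell (univ : Set Y) n => RelCWComplex.closedCell c.1 c.2

/-- The 1-skeleton as a multigraph. A vertex is a point of `Y` which is a `0`-cell; the edges are
the `1`-cells. -/
def skeletonGraph : Graph Y (RelCWComplex.cell (univ : Set Y) 1) where
  vertexSet := {x | ∃ i : RelCWComplex.cell (univ : Set Y) 0, RelCWComplex.closedCell 0 i = {x}}
  IsLink e x y := RelCWComplex.cellFrontier 1 e = {x, y}
  isLink_symm := by
    intro e _
    exact ⟨fun x y h => by rw [h, pair_comm]⟩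
  eq_or_eq_of_isLink_of_isLink := by
    intro e x y z w h h'
    have hx : x ∈ ({z, w} : Set Y) := by rw [← h', h]; simp
    simpa using hx
  left_mem_of_isLink := by
    intro e x y h
    obtain ⟨a, b, hab⟩ := CWComplex.exists_cellFrontier_one_eq e
    have hx : x ∈ RelCWComplex.closedCell 0 a ∪ RelCWComplex.closedCell 0 b := by
      rw [← hab, h]; simp
    rcases hx with hx | hx
    · refine ⟨a, ?_⟩
      rw [RelCWComplex.closedCell_zero_eq_singleton] at hx ⊢
      rw [mem_singleton_iff.1 hx]
    · refine ⟨b, ?_⟩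
      rw [RelCWComplex.closedCell_zero_eq_singleton] at hx ⊢
      rw [mem_singleton_iff.1 hx]

variable {Y}

/-- The underlying set of a finite subcomplex. -/
def IsFiniteSubcomplex (K : Set Y) : Prop :=
  ∃ L : RelCWComplex.Subcomplex (univ : Set Y), (L : Set Y) = K ∧ Finite (Σ n, L.I n)

/-- There is an edge path of length at most `n` from `x` to `y`. -/
def EdgeDistLE (n : ℕ) (x y : Y) : Prop :=
  ∃ p, IsEdgePath (skeletonGraph Y) x p y ∧ p.length ≤ n

/-- There is an edge path from `x` to `y` with image in `A`. -/
def JoinedInByEdges (A : Set Y) (x y : Y) : Prop :=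
  ∃ p, IsEdgePath (skeletonGraph Y) x p y ∧ x ∈ A ∧ ∀ d ∈ p, RelCWComplex.closedCell 1 d.1 ⊆ A

/-- Any two vertices in `A` are joined by an edge path in `A`. -/
def EdgePathConnected (A : Set Y) : Prop :=
  ∀ x ∈ (skeletonGraph Y).vertexSet, ∀ y ∈ (skeletonGraph Y).vertexSet,
    x ∈ A → y ∈ A → JoinedInByEdges A x y

/-- Proper edge path rays with image in `A`; properness is with respect to compact subsets of
`Y`. -/
def ProperRayIn (A : Set Y) : Type u :=
  {r : EdgeRay (skeletonGraph Y) //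
    (∀ k, RelCWComplex.closedCell 1 (r.edge k) ⊆ A) ∧
    ∀ F : Set Y, IsCompact F → {k | (RelCWComplex.closedCell 1 (r.edge k) ∩ F).Nonempty}.Finite}

/-- Two proper rays in `A` are equivalent if for any compact `F` there is an edge path from a vertex
of the first to a vertex of the second with image in `A - F`. -/
def ProperRayIn.Equiv {A : Set Y} (r s : ProperRayIn A) : Prop :=
  ∀ F : Set Y, IsCompact F → ∃ i j : ℕ, JoinedInByEdges (A \ F) (r.1.vert i) (s.1.vert j)

/-- The classes of proper edge path rays in `A`. (The relation `ProperRayIn.Equiv` is an equivalence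
relation.) -/
def RayEnds (A : Set Y) : Type u := Quot (ProperRayIn.Equiv (A := A))

/-- The class of a ray. -/
def ProperRayIn.toEnd {A : Set Y} (r : ProperRayIn A) : RayEnds A := Quot.mk _ r

/-- The map on classes of rays induced by an inclusion `A ⊆ B`. -/
def RayEnds.incl {A B : Set Y} (h : A ⊆ B) : RayEnds A → RayEnds B :=
  Quot.map (fun r => ⟨r.1, fun k => (r.2.1 k).trans h, r.2.2⟩) (by
    intro r s hrs F hF
    obtain ⟨i, j, p, hp, hx, hd⟩ := hrs F hF
    exact ⟨i, j, p, hp, sdiff_subset_sdiff_left h hx,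
      fun d hdp => (hd d hdp).trans (sdiff_subset_sdiff_left h)⟩)

end Complex

/-! ### Group actions -/

section Action

/-- The union `J · K` of the translates of `K`. -/
def orbitSet (J : Type v) [Group J] {Y : Type u} [MulAction J Y] (K : Set Y) : Set Y :=
  ⋃ g : J, g • K

theorem orbitSet_mono (J : Type v) [Group J] {Y : Type u} [MulAction J Y] {K L : Set Y}
    (h : K ⊆ L) : orbitSet J K ⊆ orbitSet J L :=
  iUnion_mono fun _ => smul_set_mono h

variable (J : Type v) [Group J] {Y : Type u} [TopologicalSpace Y] [MulAction J Y]

/-- A set is `J`-bounded if it is contained in `J · K` for some compact set `K`. -/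
def JBounded (A : Set Y) : Prop := ∃ K : Set Y, IsCompact K ∧ A ⊆ orbitSet J K

/-- `U` is a `J`-unbounded component of `Y - J · C`. -/
def IsJUnboundedComponent (C U : Set Y) : Prop :=
  (∃ x ∈ (orbitSet J C)ᶜ, U = connectedComponentIn (orbitSet J C)ᶜ x) ∧ ¬ JBounded J U

variable [CWComplex (univ : Set Y)]

/-- `J` acts on `Y` by cell preserving covering transformations: the quotient map is a covering map
with group `J` and each element of `J` permutes the open cells of each dimension. -/
structure IsCellularCoveringAction (J : Type v) [Group J] (Y : Type u) [TopologicalSpace Y]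
    [MulAction J Y] [CWComplex (univ : Set Y)] : Prop where
  covering : IsQuotientCoveringMap (Quotient.mk (MulAction.orbitRel J Y)) J
  cells : ∀ (g : J) (n : ℕ) (i : RelCWComplex.cell (univ : Set Y) n),
    ∃ j : RelCWComplex.cell (univ : Set Y) n, g • RelCWComplex.openCell n i = RelCWComplex.openCell n j

variable {J}

/-- An `S`-equivariant map from the Cayley graph of `S` with respect to `A` to `Y` which takes `s`
to `s • b` and maps each edge to an edge path: the edge `(s, a)` is mapped to the edge path
`path s a` from `s • b` to `(s * a) • b`. -/
structure CayleyMap (S : Subgroup J) (A : Set S) (b : Y) where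
  path : S → A → List (RelCWComplex.cell (univ : Set Y) 1 × Y)
  isEdgePath : ∀ (s : S) (a : A),
    IsEdgePath (skeletonGraph Y) (s • b) (path s a) ((s * (a : S)) • b)
  equivariant : ∀ (t s : S) (a : A),
    (path (t * s) a).map (fun d => (RelCWComplex.closedCell 1 d.1, d.2)) =
      (path s a).map (fun d => (t • RelCWComplex.closedCell 1 d.1, t • d.2))

/-- The vertices of the edge path ray `m(q)`. -/
def CayleyMap.rayVertices {S : Subgroup J} {A : Set S} {b : Y} (m : CayleyMap S A b)
    (q : CayleyRay A) : Set Y :=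
  {x | ∃ k : ℕ, x = (q.1.edge k).1 • b ∨ ∃ d ∈ m.path (q.1.edge k).1 (q.1.edge k).2, x = d.2}

/-- Each vertex of `m(q)` is joined by an edge path of length at most `I` to a vertex of `t`, and
each vertex of `t` to a vertex of `m(q)`. -/
def CayleyMap.Tracks {S : Subgroup J} {A : Set S} {b : Y} (m : CayleyMap S A b)
    (I : ℕ) (q : CayleyRay A) {B : Set Y} (t : ProperRayIn B) : Prop :=
  (∀ x ∈ m.rayVertices q, ∃ k, EdgeDistLE I x (t.1.vert k)) ∧
    ∀ k, ∃ x ∈ m.rayVertices q, EdgeDistLE I (t.1.vert k) x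

variable (J) in
/-- The set `𝓔(U, E)` of classes of proper edge path rays in `U ∩ J · E`. For compact `E` these rays
are automatically `J`-bounded. -/
abbrev JBoundedEnds (U E : Set Y) : Type u := RayEnds (U ∩ orbitSet J E)

end Action

end JEnd

/-! By local finiteness, compact sets can be traded for finite sets of vertices, so both kinds of
ends depend only on an adjacency relation on vertices. A translate of `U` by `J` equals `U` or is
disjoint from it; hence the stabilizer `S` acts freely and with finitely many orbits of edges on `U
∩ J·E`, for each compact `E`. For such actions an equivariant map that sends adjacent points to
connected ones automatically respects connection outside finite sets
(`coarselyConn_of_equivariant`), and the image of a proper ray is followed by a proper ray at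
bounded distance (`exists_properRay_of_equivariant`). What remains is to find equivariant maps and
to check plain connectivity.

The maps are `s ↦ s • u`, for a vertex `u` of `U`, and any equivariant `ψ : Y → S`, which exists by
freeness. Take `D = C ∪ D₀`, where `D₀ ⊆ U` is a finite union of edge paths from `u` to the points
`a • u`, `a ∈ A`, and to representatives of the finitely many `S`-orbits of vertices of `U` adjacent
to `J·C`. The orbit `S·u` is then connected in `U ∩ J·D`, and each endpoint `x` of an edge there is
joined to `ψ x • u`. So the two maps are mutually inverse on ends.

For `E ⊇ D` the map `y ↦ ψ y • u` turns connections in `U ∩ J·E` into connections in `U ∩ J·D`,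
which gives injectivity. For a connected subcomplex `E`, a vertex `x` of `U ∩ gE` is joined to `g •
u` inside `gE` (`reflTransGen_edgeRel_of_isPreconnected`). The path stays in `U`, and then `g ∈ S`,
or it reaches a vertex adjacent to `J·C` (`IsJUnboundedComponent.reflTransGen_inter`). Either way
`x` is joined to `S·u` in `U ∩ J·E`, which gives surjectivity. The constant `I` is a maximum over
finitely many orbit representatives. -/

namespace JEnd

/-! ### Sequences in a set with a relation, up to connection outside finite sets -/

section Coarse

variable {V W : Type*} {R R' : V → V → Prop} {T : W → W → Prop}

/-- `x` and `y` are joined by an `R`-path that avoids `F`. -/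
def ConnOff (R : V → V → Prop) (F : Set V) (x y : V) : Prop :=
  x ∉ F ∧ Relation.ReflTransGen (fun a b => R a b ∧ a ∉ F ∧ b ∉ F) x y

theorem ConnOff.right {F : Set V} {x y : V} (h : ConnOff R F x y) : y ∉ F := by
  obtain ⟨hx, h⟩ := h
  induction h with
  | refl => exact hx
  | tail _ h _ => exact h.2.2

theorem ConnOff.trans {F : Set V} {x y z : V} (h : ConnOff R F x y) (h' : ConnOff R F y z) :
    ConnOff R F x z :=
  ⟨h.1, h.2.trans h'.2⟩

theorem ConnOff.symm (hR : ∀ ⦃x y⦄, R x y → R y x) {F : Set V} {x y : V} (h : ConnOff R F x y) :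
    ConnOff R F y x := by
  refine ⟨h.right, ?_⟩
  have : Std.Symm (fun a b => R a b ∧ a ∉ F ∧ b ∉ F) := ⟨fun a b h => ⟨hR h.1, h.2.2, h.2.1⟩⟩
  exact Relation.ReflTransGen.stdSymm.symm _ _ h.2

theorem ConnOff.mono (hR : ∀ x y, R x y → R' x y) {F F' : Set V} (hF : F' ⊆ F) {x y : V}
    (h : ConnOff R F x y) : ConnOff R' F' x y :=
  ⟨fun hx => h.1 (hF hx), Relation.ReflTransGen.mono (p := fun a b => R' a b ∧ a ∉ F' ∧ b ∉ F') (fun _ _ h =>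
    ⟨hR _ _ h.1, fun hx => h.2.1 (hF hx), fun hx => h.2.2 (hF hx)⟩) _ _ h.2⟩

theorem ConnOff.single {F : Set V} {x y : V} (h : R x y) (hx : x ∉ F) (hy : y ∉ F) :
    ConnOff R F x y :=
  ⟨hx, .single ⟨h, hx, hy⟩⟩

/-- Consecutive terms of the sequence are eventually connected outside any finite set. -/
def IsCoarseRay (R : V → V → Prop) (x : ℕ → V) : Prop :=
  ∀ F : Set V, F.Finite → ∃ N, ∀ k ≥ N, ConnOff R F (x k) (x (k + 1))

/-- Outside any finite set a term of the first sequence is connected to a term of the second. -/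
def SeqEquiv (R : V → V → Prop) (x y : ℕ → V) : Prop :=
  ∀ F : Set V, F.Finite → ∃ i j, ConnOff R F (x i) (y j)

/-- Consecutive terms are related and no value is taken infinitely often. -/
structure IsProperRay (R : V → V → Prop) (x : ℕ → V) : Prop where
  adj : ∀ k, R (x k) (x (k + 1))
  finite : ∀ v, {k | x k = v}.Finite

theorem IsProperRay.finite_preimage {x : ℕ → V} (h : IsProperRay R x) {F : Set V}
    (hF : F.Finite) : {k | x k ∈ F}.Finite := by
  have : {k | x k ∈ F} = ⋃ v ∈ F, {k | x k = v} := by ext; simp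
  rw [this]
  exact hF.biUnion fun v _ => h.finite v

theorem IsProperRay.eventually_notMem {x : ℕ → V} (h : IsProperRay R x) {F : Set V}
    (hF : F.Finite) : ∃ N, ∀ k ≥ N, x k ∉ F := by
  obtain ⟨N, hN⟩ := (h.finite_preimage hF).bddAbove
  exact ⟨N + 1, fun k hk hx => by have := hN hx; omega⟩

theorem IsProperRay.isCoarseRay {x : ℕ → V} (h : IsProperRay R x) : IsCoarseRay R x := by
  intro F hF
  obtain ⟨N, hN⟩ := h.eventually_notMem hF
  exact ⟨N, fun k hk => .single (h.adj k) (hN k hk) (hN _ (by omega))⟩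

theorem IsCoarseRay.mono {x : ℕ → V} (hR : ∀ x y, R x y → R' x y) (h : IsCoarseRay R x) :
    IsCoarseRay R' x := fun F hF =>
  let ⟨N, hN⟩ := h F hF
  ⟨N, fun k hk => (hN k hk).mono hR subset_rfl⟩

theorem IsCoarseRay.exists_connOff (hR : ∀ ⦃x y⦄, R x y → R y x) {x : ℕ → V} (h : IsCoarseRay R x)
    {F : Set V} (hF : F.Finite) : ∃ N, ∀ i ≥ N, ∀ j ≥ N, ConnOff R F (x i) (x j) := by
  obtain ⟨N, hN⟩ := h F hF
  have key : ∀ i ≥ N, ConnOff R F (x N) (x i) := by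
    intro i hi
    induction i, hi using Nat.le_induction with
    | base => exact ⟨(hN N le_rfl).1, .refl⟩
    | succ i hi ih => exact ih.trans (hN i hi)
  exact ⟨N, fun i hi j hj => ((key i hi).symm hR).trans (key j hj)⟩

theorem SeqEquiv.symm (hR : ∀ ⦃x y⦄, R x y → R y x) {x y : ℕ → V} (h : SeqEquiv R x y) : SeqEquiv R y x :=
  fun F hF => let ⟨i, j, hij⟩ := h F hF; ⟨j, i, hij.symm hR⟩

theorem SeqEquiv.mono (hR : ∀ x y, R x y → R' x y) {x y : ℕ → V} (h : SeqEquiv R x y) :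
    SeqEquiv R' x y :=
  fun F hF => let ⟨i, j, hij⟩ := h F hF; ⟨i, j, hij.mono hR subset_rfl⟩

theorem SeqEquiv.refl {x : ℕ → V} (h : IsCoarseRay R x) : SeqEquiv R x x :=
  fun F hF => let ⟨N, hN⟩ := h F hF; ⟨N, N + 1, hN N le_rfl⟩

/-- Adding an initial segment of `y` to `F` forces both connections to meet `y` so late that its own
terms are connected outside `F`. -/
theorem SeqEquiv.trans (hR : ∀ ⦃x y⦄, R x y → R y x) {x y z : ℕ → V} (hy : IsCoarseRay R y)
    (h : SeqEquiv R x y) (h' : SeqEquiv R y z) : SeqEquiv R x z := by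
  intro F hF
  obtain ⟨N, hN⟩ := hy.exists_connOff hR hF
  have hF' : (F ∪ y '' Set.Iio N).Finite := hF.union ((Set.finite_Iio N).image y)
  obtain ⟨i, j, hij⟩ := h _ hF'
  obtain ⟨k, l, hkl⟩ := h' _ hF'
  have hj : N ≤ j := by
    by_contra hlt
    exact hij.right (Or.inr ⟨j, by simpa using hlt, rfl⟩)
  have hk : N ≤ k := by
    by_contra hlt
    exact hkl.1 (Or.inr ⟨k, by simpa using hlt, rfl⟩)
  have hsub : F ⊆ F ∪ y '' Set.Iio N := subset_union_left
  exact ⟨i, l, ((hij.mono (fun _ _ h => h) hsub).trans (hN j hj k hk)).trans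
    (hkl.mono (fun _ _ h => h) hsub)⟩

/-- Related elements outside a suitable finite set have images which are connected outside a given
finite set. -/
def CoarselyConn (R : V → V → Prop) (T : W → W → Prop) (α β : V → W) : Prop :=
  ∀ F : Set W, F.Finite → ∃ F' : Set V, F'.Finite ∧
    ∀ x y, R x y → x ∉ F' → ConnOff T F (α x) (β y)

theorem CoarselyConn.isCoarseRay {α : V → W} (h : CoarselyConn R T α α) {x : ℕ → V}
    (hx : IsProperRay R x) : IsCoarseRay T (α ∘ x) := by
  intro F hF
  obtain ⟨F', hF', hc⟩ := h F hF
  obtain ⟨N, hN⟩ := hx.eventually_notMem hF'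
  exact ⟨N, fun k hk => hc _ _ (hx.adj k) (hN k hk)⟩

theorem CoarselyConn.seqEquiv_comp {α β : V → W} (h : CoarselyConn R T α β) {x : ℕ → V}
    (hx : IsProperRay R x) : SeqEquiv T (α ∘ x) (β ∘ x) := by
  intro F hF
  obtain ⟨F', hF', hc⟩ := h F hF
  obtain ⟨N, hN⟩ := hx.eventually_notMem hF'
  exact ⟨N, N + 1, hc _ _ (hx.adj N) (hN N le_rfl)⟩

theorem CoarselyConn.map_seqEquiv {α : V → W} (h : CoarselyConn R T α α) {x y : ℕ → V}
    (hx : ∀ k, R (x k) (x (k + 1))) (hxy : SeqEquiv R x y) : SeqEquiv T (α ∘ x) (α ∘ y) := by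
  intro F hF
  obtain ⟨F', hF', hc⟩ := h F hF
  obtain ⟨i, j, hi, hij⟩ := hxy F' hF'
  refine ⟨i, j, ?_⟩
  simp only [Function.comp_apply]
  generalize y j = z at hij
  induction hij with
  | refl => exact ⟨(hc _ _ (hx i) hi).1, .refl⟩
  | tail _ hb ih => exact ih.trans (hc _ _ hb.1 hb.2.1)

end Coarse

/-! ### Equivariant maps between cofinite relations -/

section Equivariant

variable {S V W : Type*} [Group S] [MulAction S V] [MulAction S W]

/-- The pairs of related elements lie in finitely many orbits. -/
def IsCofiniteRel (S : Type*) {V : Type*} [Group S] [MulAction S V] (R : V → V → Prop) : Prop :=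
  ∃ P : Set (V × V), P.Finite ∧ ∀ x y, R x y → ∃ s : S, ∃ p ∈ P, x = s • p.1 ∧ y = s • p.2

/-- The relation is invariant under the group. -/
def IsInvRel (S : Type*) {V : Type*} [Group S] [MulAction S V] (R : V → V → Prop) : Prop :=
  ∀ (s : S) x y, R x y → R (s • x) (s • y)

theorem IsInvRel.reflTransGen {T : W → W → Prop} (hT : IsInvRel S T) (s : S) {x y : W}
    (h : Relation.ReflTransGen T x y) : Relation.ReflTransGen T (s • x) (s • y) :=
  h.lift _ fun _ _ h => hT s _ _ h

theorem IsInvRel.reflTransGen_iff {T : W → W → Prop} (hT : IsInvRel S T) (s : S) {x y : W} :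
    Relation.ReflTransGen T (s • x) (s • y) ↔ Relation.ReflTransGen T x y :=
  ⟨fun h => by simpa using hT.reflTransGen s⁻¹ h, hT.reflTransGen s⟩

theorem IsInvRel.transGen_iff {T : W → W → Prop} (hT : IsInvRel S T) (s : S) {x y : W} :
    Relation.TransGen T (s • x) (s • y) ↔ Relation.TransGen T x y := by
  refine ⟨fun h => ?_, fun h => h.lift _ fun _ _ h => hT s _ _ h⟩
  have := h.lift (p := T) (s⁻¹ • ·) fun _ _ h => hT s⁻¹ _ _ h
  simpa [Function.onFun] using this

/-- Freeness gives at most one `s` for each pair of points. This is the only source of properness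
for the equivariant maps below. -/
theorem finite_smul_mem (hW : ∀ (s t : S) (w : W), s • w = t • w → s = t) {L F : Set W}
    (hL : L.Finite) (hF : F.Finite) : {s : S | ∃ v ∈ L, s • v ∈ F}.Finite := by
  have : {s : S | ∃ v ∈ L, s • v ∈ F} = ⋃ v ∈ L, ⋃ w ∈ F, {s : S | s • v = w} := by
    ext s; simp
  rw [this]
  refine hL.biUnion fun v _ => hF.biUnion fun w _ => Set.Subsingleton.finite ?_
  intro s hs t ht
  exact hW s t v (hs.trans ht.symm)

theorem exists_finite_reflTransGen {T : W → W → Prop} {x y : W}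
    (h : Relation.ReflTransGen T x y) : ∃ L : Set W, L.Finite ∧ x ∈ L ∧
      Relation.ReflTransGen (fun a b => T a b ∧ a ∈ L ∧ b ∈ L) x y := by
  induction h with
  | refl => exact ⟨{x}, finite_singleton x, rfl, .refl⟩
  | @tail b c _ hbc ih =>
    obtain ⟨L, hL, hx, h⟩ := ih
    refine ⟨L ∪ {b, c}, hL.union (by simp), Or.inl hx, ?_⟩
    exact (h.lift id fun _ _ h => ⟨h.1, Or.inl h.2.1, Or.inl h.2.2⟩).tail
      ⟨hbc, by simp, by simp⟩

/-- Choose one path for each of the finitely many representative pairs. Every other connection can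
be taken to be a translate of one of these, and only finitely many translates meet `F`; the starting
points of those form `F'`. -/
theorem coarselyConn_of_equivariant (hW : ∀ (s t : S) (w : W), s • w = t • w → s = t)
    {R : V → V → Prop} (hR : IsCofiniteRel S R) {T : W → W → Prop} (hT : IsInvRel S T)
    {α β : V → W} (hα : ∀ (s : S) v, α (s • v) = s • α v) (hβ : ∀ (s : S) v, β (s • v) = s • β v)
    (h : ∀ x y, R x y → Relation.ReflTransGen T (α x) (β y)) : CoarselyConn R T α β := by
  intro F hF
  obtain ⟨P, hP, hPR⟩ := hR
  have hL : ∀ p : V × V, ∃ L : Set W, L.Finite ∧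
      (Relation.ReflTransGen T (α p.1) (β p.2) → α p.1 ∈ L ∧
        Relation.ReflTransGen (fun a b => T a b ∧ a ∈ L ∧ b ∈ L) (α p.1) (β p.2)) := by
    intro p
    by_cases hp : Relation.ReflTransGen T (α p.1) (β p.2)
    · obtain ⟨L, hL, h1, h2⟩ := exists_finite_reflTransGen hp
      exact ⟨L, hL, fun _ => ⟨h1, h2⟩⟩
    · exact ⟨∅, finite_empty, fun h => absurd h hp⟩
  choose L hLfin hL using hL
  refine ⟨⋃ p ∈ P, (fun s : S => s • p.1) '' {s | ∃ v ∈ L p, s • v ∈ F},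
    hP.biUnion fun p _ => (finite_smul_mem hW (hLfin p) hF).image _, ?_⟩
  intro x y hxy hx
  obtain ⟨s, p, hp, rfl, rfl⟩ := hPR x y hxy
  have hs : ∀ v ∈ L p, s • v ∉ F := by
    intro v hv hvF
    exact hx (mem_biUnion hp ⟨s, ⟨v, hv, hvF⟩, rfl⟩)
  have hpath := h _ _ hxy
  rw [hα, hβ, hT.reflTransGen_iff] at hpath
  obtain ⟨h1, h2⟩ := hL p hpath
  rw [hα, hβ]
  exact ⟨hs _ h1, h2.lift (s • ·) fun a b hab => ⟨hT s _ _ hab.1, hs _ hab.2.1, hs _ hab.2.2⟩⟩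

theorem exists_path_of_transGen {T : W → W → Prop} {x y : W} (h : Relation.TransGen T x y) :
    ∃ (g : ℕ → W) (n : ℕ), 0 < n ∧ g 0 = x ∧ g n = y ∧ ∀ i < n, T (g i) (g (i + 1)) := by
  induction h with
  | @single b hb =>
    exact ⟨fun i => if i = 0 then x else b, 1, one_pos, by simp, by simp,
      fun i hi => by obtain rfl : i = 0 := by omega
                     simpa using hb⟩
  | @tail b c _ hbc ih =>
    obtain ⟨g, n, hn, h0, h1, h⟩ := ih
    refine ⟨fun i => if i ≤ n then g i else c, n + 1, by omega, by simp [h0], by simp, ?_⟩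
    intro i hi
    rcases Nat.lt_succ_iff_lt_or_eq.1 hi with hi | rfl
    · simp only [hi.le, if_true, Nat.succ_le_iff.2 hi]
      exact h i hi
    · simpa [h1] using hbc

/-- Enumeration of the pairs `(k, i)` with `i < n k` in lexicographic order. -/
theorem exists_block_enumeration (n : ℕ → ℕ) (hn : ∀ k, 0 < n k) :
    ∃ κ ι : ℕ → ℕ, (∀ m, ι m < n (κ m)) ∧
      (∀ m, (κ (m + 1) = κ m ∧ ι (m + 1) = ι m + 1) ∨
        (κ (m + 1) = κ m + 1 ∧ ι (m + 1) = 0 ∧ ι m + 1 = n (κ m))) ∧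
      (∀ k, {m | κ m = k}.Finite) ∧ ∀ k, ∃ m, κ m = k ∧ ι m = 0 := by
  -- The state is (block, position in the block); the position advances until the block is
  -- exhausted.
  let st : ℕ → ℕ × ℕ := fun m => Nat.rec (0, 0)
    (fun _ q => if q.2 + 1 < n q.1 then (q.1, q.2 + 1) else (q.1 + 1, 0)) m
  have st_succ : ∀ m, st (m + 1) =
      if (st m).2 + 1 < n (st m).1 then ((st m).1, (st m).2 + 1) else ((st m).1 + 1, 0) :=
    fun m => rfl
  have hlt : ∀ m, (st m).2 < n (st m).1 := by
    intro m
    induction m with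
    | zero => exact hn 0
    | succ m ih =>
      rw [st_succ]
      split_ifs with h
      · exact h
      · exact hn _
  have hstep : ∀ m, ((st (m + 1)).1 = (st m).1 ∧ (st (m + 1)).2 = (st m).2 + 1) ∨
        ((st (m + 1)).1 = (st m).1 + 1 ∧ (st (m + 1)).2 = 0 ∧ (st m).2 + 1 = n (st m).1) := by
    intro m
    rw [st_succ]
    split_ifs with h
    · exact Or.inl ⟨rfl, rfl⟩
    · exact Or.inr ⟨rfl, rfl, le_antisymm (hlt m) (not_lt.1 h)⟩
  have hsum : ∀ m, m = ∑ j ∈ Finset.range (st m).1, n j + (st m).2 := by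
    intro m
    induction m with
    | zero => simp [st]
    | succ m ih =>
      rcases hstep m with ⟨h1, h2⟩ | ⟨h1, h2, h3⟩
      · rw [h1, h2]; omega
      · rw [h1, h2, Finset.sum_range_succ]; omega
  refine ⟨fun m => (st m).1, fun m => (st m).2, hlt, hstep, fun k => ?_, fun k => ?_⟩
  · refine (finite_Iio (∑ j ∈ Finset.range (k + 1), n j)).subset ?_
    rintro m rfl
    have h1 := hsum m
    have h2 := hlt m
    have h3 := Finset.sum_range_succ n (st m).1
    simp only [mem_Iio]
    omega
  · induction k with
    | zero => exact ⟨0, rfl, rfl⟩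
    | succ k ih =>
      obtain ⟨m, hm, hm0⟩ := ih
      have key : ∀ i < n k, (st (m + i)).1 = k ∧ (st (m + i)).2 = i := by
        intro i hi
        induction i with
        | zero => exact ⟨hm, hm0⟩
        | succ i ih =>
          obtain ⟨h1, h2⟩ := ih (by omega)
          rcases hstep (m + i) with ⟨h3, h4⟩ | ⟨h3, h4, h5⟩
          · exact ⟨h3.trans h1, by rw [← add_assoc, h4, h2]⟩
          · rw [h1, h2] at h5; omega
      obtain ⟨h1, h2⟩ := key (n k - 1) (by have := hn k; omega)
      rcases hstep (m + (n k - 1)) with ⟨h3, h4⟩ | ⟨h3, h4, h5⟩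
      · have := hlt (m + (n k - 1) + 1)
        rw [h3, h4, h1, h2] at this
        have := hn k
        omega
      · exact ⟨m + (n k - 1) + 1, h3.trans (by rw [h1]), h4⟩

/-- Under an equivariant map that takes related elements to connected ones the image of a proper ray
is followed by a proper ray, at a distance that is uniformly bounded. -/
theorem exists_properRay_of_equivariant (hW : ∀ (s t : S) (w : W), s • w = t • w → s = t)
    {R : V → V → Prop} (hR : IsCofiniteRel S R) {T : W → W → Prop} (hT : IsInvRel S T)
    (hTs : ∀ ⦃x y⦄, T x y → T y x)
    {α : V → W} (hα : ∀ (s : S) v, α (s • v) = s • α v)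
    (h : ∀ x y, R x y → Relation.ReflTransGen T (α x) (α y)) :
    ∃ B : Set (V × W), B.Finite ∧ ∀ r, IsProperRay R r →
      ∃ f, IsProperRay T f ∧ SeqEquiv T f (α ∘ r) ∧ (∀ k, ∃ n, f n = α (r k)) ∧
        ∀ n, ∃ k, ∃ s : S, ∃ p ∈ B, r k = s • p.1 ∧ f n = s • p.2 := by
  obtain ⟨P, hP, hPR⟩ := hR
  have hg : ∀ p : V × V, ∃ (g : ℕ → W) (n : ℕ), 0 < n ∧
      (Relation.TransGen T (α p.1) (α p.2) →
        g 0 = α p.1 ∧ g n = α p.2 ∧ ∀ i < n, T (g i) (g (i + 1))) := by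
    intro p
    by_cases hp : Relation.TransGen T (α p.1) (α p.2)
    · obtain ⟨g, n, hn, hg⟩ := exists_path_of_transGen hp
      exact ⟨g, n, hn, fun _ => hg⟩
    · exact ⟨fun _ => α p.1, 1, one_pos, fun h => absurd h hp⟩
  choose g n hn hg using hg
  refine ⟨⋃ p ∈ P, (fun i => (p.1, g p i)) '' Iio (n p),
    hP.biUnion fun p _ => (finite_Iio _).image _, fun r hr => ?_⟩
  -- The map `α` is finite-to-one along `r`, because each term of `r` is a translate of one of
  -- finitely many points.
  have hfib : ∀ F : Set W, F.Finite → {k | α (r k) ∈ F}.Finite := by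
    intro F hF
    have hfin : (⋃ p ∈ P, (fun s : S => s • p.1) ''
        {s | ∃ v ∈ ({α p.1} : Set W), s • v ∈ F}).Finite :=
      hP.biUnion fun p _ => (finite_smul_mem hW (finite_singleton _) hF).image _
    refine (hr.finite_preimage hfin).subset fun k hk => ?_
    obtain ⟨s, p, hp, h1, -⟩ := hPR _ _ (hr.adj k)
    refine mem_biUnion hp ⟨s, ⟨α p.1, rfl, ?_⟩, h1.symm⟩
    rw [← hα, ← h1]
    exact hk
  have hchain : ∀ k i, Relation.ReflTransGen T (α (r k)) (α (r (k + i))) := by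
    intro k i
    induction i with
    | zero => exact .refl
    | succ i ih => exact ih.trans (h _ _ (hr.adj _))
  -- Each block must have positive length, also when `α (r k) = α (r (k + 1))`. The images leave `α
  -- (r k)` eventually, so it has a neighbour `c`, and one can go to `c` and back first.
  have htrans : ∀ k, Relation.TransGen T (α (r k)) (α (r (k + 1))) := by
    intro k
    obtain ⟨N, hN⟩ := (hfib {α (r k)} (finite_singleton _)).bddAbove
    have hne : α (r (k + (N + 1))) ≠ α (r k) := by
      intro he
      have := hN (show k + (N + 1) ∈ {j | α (r j) ∈ ({α (r k)} : Set W)} from he)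
      omega
    rcases (Relation.ReflTransGen.cases_head (hchain k (N + 1))) with he | ⟨c, hc, -⟩
    · exact absurd he.symm hne
    · exact ((Relation.TransGen.single hc).tail (hTs hc)).trans_left (h _ _ (hr.adj k))
  choose s p hp h1 h2 using fun k => hPR _ _ (hr.adj k)
  have hgk : ∀ k, g (p k) 0 = α (p k).1 ∧ g (p k) (n (p k)) = α (p k).2 ∧
      ∀ i < n (p k), T (g (p k) i) (g (p k) (i + 1)) := by
    intro k
    refine hg _ ?_
    have := htrans k
    rwa [h1 k, h2 k, hα, hα, hT.transGen_iff] at this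
  obtain ⟨κ, ι, hlt, hstep, hκfin, hκ⟩ := exists_block_enumeration (fun k => n (p k))
    (fun k => hn _)
  have hsurj : ∀ k, ∃ m, s (κ m) • g (p (κ m)) (ι m) = α (r k) := by
    intro k
    obtain ⟨m, rfl, hm0⟩ := hκ k
    exact ⟨m, by rw [hm0, (hgk _).1, ← hα, ← h1]⟩
  refine ⟨fun m => s (κ m) • g (p (κ m)) (ι m), ⟨fun m => ?_, fun w => ?_⟩, ?_, hsurj, ?_⟩
  · rcases hstep m with ⟨h3, h4⟩ | ⟨h3, h4, h5⟩
    · simp only [h3, h4]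
      exact hT _ _ _ ((hgk _).2.2 _ (hlt m))
    · have : s (κ (m + 1)) • g (p (κ (m + 1))) (ι (m + 1)) =
          s (κ m) • g (p (κ m)) (ι m + 1) := by
        rw [h4, (hgk _).1, ← hα, ← h1, h3, h2, h5, (hgk _).2.1, ← hα]
      simp only [this]
      exact hT _ _ _ ((hgk _).2.2 _ (hlt m))
  -- A visit to `w` in block `k` confines `s k` to a finite set, hence `r k` as well; `r` is proper
  -- and each block is finite.
  · have hL : (⋃ q ∈ P, g q '' Iio (n q)).Finite :=
      hP.biUnion fun q _ => (finite_Iio _).image _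
    have hG : (image2 (fun (t : S) (q : V × V) => t • q.1)
        {t : S | ∃ v ∈ ⋃ q ∈ P, g q '' Iio (n q), t • v ∈ ({w} : Set W)} P).Finite :=
      (finite_smul_mem hW hL (finite_singleton w)).image2 _ hP
    have hK := hr.finite_preimage hG
    have hM : (⋃ k ∈ {k | r k ∈ image2 (fun (t : S) (q : V × V) => t • q.1)
        {t : S | ∃ v ∈ ⋃ q ∈ P, g q '' Iio (n q), t • v ∈ ({w} : Set W)} P},
        {m | κ m = k}).Finite := hK.biUnion fun k _ => hκfin k
    refine hM.subset fun m hm => mem_biUnion (x := κ m) ?_ rfl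
    exact ⟨s (κ m), ⟨_, mem_biUnion (hp (κ m)) ⟨ι m, hlt m, rfl⟩, hm⟩, p (κ m), hp _, (h1 _).symm⟩
  · intro F hF
    obtain ⟨k, hk⟩ := (hfib F hF).exists_notMem
    obtain ⟨m, hm⟩ := hsurj k
    refine ⟨m, k, ?_⟩
    simp only [hm, Function.comp_apply]
    exact ⟨hk, .refl⟩
  · intro m
    exact ⟨κ m, s (κ m), _, mem_biUnion (hp (κ m)) ⟨ι m, hlt m, rfl⟩, h1 _, rfl⟩

end Equivariant

end JEnd

namespace JEnd

/-! ### Cells, vertices and edges of a locally finite CW complex -/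

section Cells

open RelCWComplex (cell openCell closedCell cellFrontier Subcomplex)

variable {Y : Type*} [TopologicalSpace Y] [CWComplex (univ : Set Y)]

theorem exists_mem_openCell (z : Y) : ∃ n, ∃ i : cell (univ : Set Y) n, z ∈ openCell n i := by
  have : z ∈ ⋃ (n : ℕ) (j : cell (univ : Set Y) n), openCell n j := by
    rw [CWComplex.iUnion_openCell_eq_complex]; trivial
  simpa using this

theorem eq_of_mem_openCell {n m : ℕ} {i : cell (univ : Set Y) n} {j : cell (univ : Set Y) m} {z : Y}
    (hi : z ∈ openCell n i) (hj : z ∈ openCell m j) :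
    (⟨n, i⟩ : Σ n, cell (univ : Set Y) n) = ⟨m, j⟩ :=
  RelCWComplex.eq_of_not_disjoint_openCell (not_disjoint_iff.2 ⟨z, hi, hj⟩)

theorem exists_mem_openCell_of_mem_cellFrontier {n : ℕ} {i : cell (univ : Set Y) n} {z : Y}
    (h : z ∈ cellFrontier n i) : ∃ m < n, ∃ j : cell (univ : Set Y) m, z ∈ openCell m j := by
  obtain ⟨I, hI⟩ := CWComplex.cellFrontier_subset_finite_openCell n i
  have := hI h
  simp only [mem_iUnion] at this
  obtain ⟨m, hm, j, -, hj⟩ := this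
  exact ⟨m, hm, j, hj⟩

theorem mem_closedCell_iff {n : ℕ} {i : cell (univ : Set Y) n} {z : Y} :
    z ∈ closedCell n i ↔ z ∈ cellFrontier n i ∨ z ∈ openCell n i := by
  rw [← RelCWComplex.cellFrontier_union_openCell_eq_closedCell]; rfl

theorem disjoint_cellFrontier_openCell (n : ℕ) (i : cell (univ : Set Y) n) :
    Disjoint (cellFrontier n i) (openCell n i) := by
  rw [Set.disjoint_left]
  intro z hz hz'
  obtain ⟨m, hm, j, hj⟩ := exists_mem_openCell_of_mem_cellFrontier hz
  have := congrArg Sigma.fst (eq_of_mem_openCell hz' hj)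
  simp at this
  omega

theorem cellFrontier_eq_diff (n : ℕ) (i : cell (univ : Set Y) n) :
    cellFrontier n i = closedCell n i \ openCell n i := by
  ext z
  rw [mem_sdiff, mem_closedCell_iff]
  have := (disjoint_cellFrontier_openCell n i).notMem_of_mem_left (a := z)
  tauto

theorem isPreconnected_closedCell (n : ℕ) (i : cell (univ : Set Y) n) :
    IsPreconnected (closedCell n i) :=
  (convex_closedBall _ _).isPreconnected.image _ (RelCWComplex.continuousOn n i)

theorem isPreconnected_cellFrontier {n : ℕ} (hn : 2 ≤ n) (i : cell (univ : Set Y) n) :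
    IsPreconnected (cellFrontier n i) := by
  refine (isPreconnected_sphere ?_ _ _).image _
    ((RelCWComplex.continuousOn n i).mono Metric.sphere_subset_closedBall)
  rw [rank_fin_fun]
  exact_mod_cast hn

theorem openCell_zero_of_mem_vertexSet {x : Y} (hx : x ∈ (skeletonGraph Y).vertexSet) :
    ∃ i : cell (univ : Set Y) 0, openCell 0 i = {x} := by
  obtain ⟨i, hi⟩ := hx
  refine ⟨i, ?_⟩
  rw [← hi, RelCWComplex.closedCell_zero_eq_singleton, RelCWComplex.openCell_zero_eq_singleton]

theorem mem_vertexSet_of_mem_openCell {x : Y} {i : cell (univ : Set Y) 0} (hx : x ∈ openCell 0 i) :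
    x ∈ (skeletonGraph Y).vertexSet := by
  refine ⟨i, ?_⟩
  rw [RelCWComplex.openCell_zero_eq_singleton, mem_singleton_iff] at hx
  rw [RelCWComplex.closedCell_zero_eq_singleton, hx]

theorem eq_zero_of_mem_openCell {x : Y} (hx : x ∈ (skeletonGraph Y).vertexSet) {n : ℕ}
    {i : cell (univ : Set Y) n} (h : x ∈ openCell n i) : n = 0 := by
  obtain ⟨j, hj⟩ := openCell_zero_of_mem_vertexSet hx
  exact congrArg Sigma.fst (eq_of_mem_openCell h (j := j) (by rw [hj]; rfl))

theorem exists_isLink (e : cell (univ : Set Y) 1) : ∃ x y, (skeletonGraph Y).IsLink e x y := by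
  obtain ⟨x, y, h⟩ := CWComplex.exists_cellFrontier_one_eq e
  rw [RelCWComplex.closedCell_zero_eq_singleton, RelCWComplex.closedCell_zero_eq_singleton] at h
  exact ⟨_, _, h⟩

theorem isLink_iff {e : cell (univ : Set Y) 1} {x y : Y} :
    (skeletonGraph Y).IsLink e x y ↔ cellFrontier 1 e = {x, y} := Iff.rfl

theorem left_mem_closedCell {e : cell (univ : Set Y) 1} {x y : Y}
    (h : (skeletonGraph Y).IsLink e x y) : x ∈ closedCell 1 e :=
  RelCWComplex.cellFrontier_subset_closedCell _ _ (by rw [isLink_iff.1 h]; simp)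

theorem right_mem_closedCell {e : cell (univ : Set Y) 1} {x y : Y}
    (h : (skeletonGraph Y).IsLink e x y) : y ∈ closedCell 1 e :=
  left_mem_closedCell h.symm

theorem mem_vertexSet_of_mem_cellFrontier {e : cell (univ : Set Y) 1} {x : Y}
    (h : x ∈ cellFrontier 1 e) : x ∈ (skeletonGraph Y).vertexSet := by
  obtain ⟨a, b, hab⟩ := exists_isLink e
  rw [isLink_iff.1 hab] at h
  rcases h with rfl | rfl
  exacts [hab.left_mem, hab.right_mem]

theorem eq_of_mem_openCell_closedCell_one {e e' : cell (univ : Set Y) 1} {z : Y}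
    (h : z ∈ openCell 1 e) (h' : z ∈ closedCell 1 e') : e = e' := by
  rcases mem_closedCell_iff.1 h' with h' | h'
  · exact absurd (eq_zero_of_mem_openCell (mem_vertexSet_of_mem_cellFrontier h') h) one_ne_zero
  · simpa using eq_of_mem_openCell h h'

/-! ### Finiteness and closedness from local finiteness -/

section LocallyFinite

variable (hfin : LocallyFiniteCW Y)
include hfin

theorem finite_cells_inter_compact {K : Set Y} (hK : IsCompact K) :
    {c : Σ n, cell (univ : Set Y) n | (closedCell c.1 c.2 ∩ K).Nonempty}.Finite :=
  LocallyFinite.finite_nonempty_inter_compact hfin hK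

theorem finite_edges_inter_compact {K : Set Y} (hK : IsCompact K) :
    {e : cell (univ : Set Y) 1 | (closedCell 1 e ∩ K).Nonempty}.Finite :=
  (finite_cells_inter_compact hfin hK).preimage
    (f := fun e => (⟨1, e⟩ : Σ n, cell (univ : Set Y) n)) (by intro a _ b _ h; simpa using h)

theorem finite_vertices_inter_compact {K : Set Y} (hK : IsCompact K) :
    ((skeletonGraph Y).vertexSet ∩ K).Finite := by
  have h := (finite_cells_inter_compact hfin hK).biUnion
    (t := fun c => if c.1 = 0 then closedCell c.1 c.2 else ∅) (by
      rintro ⟨n, i⟩ _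
      dsimp only
      split_ifs with h
      · subst h; rw [RelCWComplex.closedCell_zero_eq_singleton]; exact finite_singleton _
      · exact finite_empty)
  refine h.subset ?_
  rintro x ⟨⟨i, hi⟩, hx⟩
  have hxi : x ∈ closedCell 0 i := by rw [hi]; rfl
  exact mem_biUnion (show (⟨0, i⟩ : Σ n, cell (univ : Set Y) n) ∈ _ from ⟨x, hxi, hx⟩) (by simpa)

theorem finite_endpoints_inter_compact {K : Set Y} (hK : IsCompact K) :
    {x | ∃ e : cell (univ : Set Y) 1, x ∈ cellFrontier 1 e ∧
      (closedCell 1 e ∩ K).Nonempty}.Finite := by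
  refine ((finite_edges_inter_compact hfin hK).biUnion (t := fun e => cellFrontier 1 e)
    fun e _ => ?_).subset ?_
  · obtain ⟨x, y, h⟩ := exists_isLink e
    rw [isLink_iff.1 h]
    simp
  · rintro x ⟨e, hx, he⟩
    exact mem_biUnion he hx

theorem isClosed_biUnion_closedCell [T2Space Y] (I : Set (Σ n, cell (univ : Set Y) n)) :
    IsClosed (⋃ c ∈ I, closedCell c.1 c.2) := by
  rw [biUnion_eq_iUnion]
  have h : LocallyFinite fun c : I => closedCell c.1.1 c.1.2 :=
    LocallyFinite.comp_injective (f := fun c : Σ n, cell (univ : Set Y) n => closedCell c.1 c.2)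
      hfin Subtype.val_injective
  exact h.isClosed_iUnion fun c => RelCWComplex.isClosed_closedCell

/-- The union of the closed cells that meet a compact set is compact. -/
theorem isCompact_closedCells_inter {K : Set Y} (hK : IsCompact K) :
    IsCompact (⋃ c ∈ {c : Σ n, cell (univ : Set Y) n | (closedCell c.1 c.2 ∩ K).Nonempty},
      closedCell c.1 c.2) :=
  (finite_cells_inter_compact hfin hK).isCompact_biUnion fun _ _ =>
    RelCWComplex.isCompact_closedCell

end LocallyFinite

theorem Subcomplex.mem_I_of_mem [T2Space Y] (L : Subcomplex (univ : Set Y)) {n : ℕ}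
    {i : cell (univ : Set Y) n} {z : Y} (hz : z ∈ openCell n i) (hL : z ∈ (L : Set Y)) :
    i ∈ L.I n := by
  by_contra h
  exact (L.disjoint_openCell_subcomplex_of_not_mem h).notMem_of_mem_left hz hL

/-- Vertices joined by an edge in `A`. -/
def EdgeRel (A : Set Y) (x y : Y) : Prop :=
  ∃ e, (skeletonGraph Y).IsLink e x y ∧ closedCell 1 e ⊆ A

theorem EdgeRel.symm {A : Set Y} ⦃x y : Y⦄ (h : EdgeRel A x y) : EdgeRel A y x :=
  let ⟨e, h, he⟩ := h; ⟨e, h.symm, he⟩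

theorem EdgeRel.mono {A B : Set Y} (h : A ⊆ B) (x y : Y) : EdgeRel A x y → EdgeRel B x y :=
  fun ⟨e, h', he⟩ => ⟨e, h', he.trans h⟩

theorem EdgeRel.left_mem {A : Set Y} {x y : Y} (h : EdgeRel A x y) : x ∈ A :=
  let ⟨_, h, he⟩ := h; he (left_mem_closedCell h)

theorem EdgeRel.left_mem_vertexSet {A : Set Y} {x y : Y} (h : EdgeRel A x y) :
    x ∈ (skeletonGraph Y).vertexSet :=
  let ⟨_, h, _⟩ := h; h.left_mem

/-! ### Topological connectedness implies connectedness by edge paths -/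

section Connectivity

/-- The predicate is constant on each closed cell of `L` of dimension less than `n`. -/
def CellwiseConstant (L : Subcomplex (univ : Set Y)) (n : ℕ) (g : Y → Prop) : Prop :=
  ∀ m < n, ∀ i ∈ L.I m, (∀ z ∈ closedCell m i, g z) ∨ ∀ z ∈ closedCell m i, ¬ g z

/-- The cells on which `g` holds and those on which it fails have disjoint unions, both closed by
local finiteness, so a preconnected set lies in one of them. -/
theorem CellwiseConstant.preconnected [T2Space Y] (hfin : LocallyFiniteCW Y) {L : Subcomplex (univ : Set Y)}
    {n : ℕ} {g : Y → Prop} (h : CellwiseConstant L n g) {P : Set Y} (hP : IsPreconnected P)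
    (hPL : ∀ z ∈ P, ∃ m < n, ∃ i ∈ L.I m, z ∈ closedCell m i) :
    (∀ z ∈ P, g z) ∨ ∀ z ∈ P, ¬ g z := by
  let I : Set (Σ n, cell (univ : Set Y) n) :=
    {c | c.1 < n ∧ c.2 ∈ L.I c.1 ∧ ∀ z ∈ closedCell c.1 c.2, g z}
  let I' : Set (Σ n, cell (univ : Set Y) n) :=
    {c | c.1 < n ∧ c.2 ∈ L.I c.1 ∧ ∀ z ∈ closedCell c.1 c.2, ¬ g z}
  have hI : ∀ z ∈ ⋃ c ∈ I, closedCell c.1 c.2, g z := by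
    intro z hz
    simp only [mem_iUnion] at hz
    obtain ⟨c, hc, hz⟩ := hz
    exact hc.2.2 z hz
  have hI' : ∀ z ∈ ⋃ c ∈ I', closedCell c.1 c.2, ¬ g z := by
    intro z hz
    simp only [mem_iUnion] at hz
    obtain ⟨c, hc, hz⟩ := hz
    exact hc.2.2 z hz
  rcases isPreconnected_iff_subset_of_disjoint_closed.1 hP _ _
    (isClosed_biUnion_closedCell hfin I) (isClosed_biUnion_closedCell hfin I') (fun z hz => by
      obtain ⟨m, hm, i, hi, hz⟩ := hPL z hz
      rcases h m hm i hi with hg | hg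
      · exact Or.inl (mem_biUnion (show (⟨m, i⟩ : Σ n, cell (univ : Set Y) n) ∈ I from
          ⟨hm, hi, hg⟩) hz)
      · exact Or.inr (mem_biUnion (show (⟨m, i⟩ : Σ n, cell (univ : Set Y) n) ∈ I' from
          ⟨hm, hi, hg⟩) hz))
    (eq_empty_of_forall_notMem fun z hz => hI' z hz.2.2 (hI z hz.2.1)) with hs | hs
  · exact Or.inl fun z hz => hI z (hs hz)
  · exact Or.inr fun z hz => hI' z (hs hz)

/-- Each open `n`-cell receives the value of `g` on its frontier, which is constant by `hfr`;
nothing changes in lower dimensions. -/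
theorem CellwiseConstant.extend {L : Subcomplex (univ : Set Y)}
    {n : ℕ} (hn : n ≠ 0) {g : Y → Prop} (h : CellwiseConstant L n g)
    (hfr : ∀ i ∈ L.I n, (∀ z ∈ cellFrontier n i, g z) ∨ ∀ z ∈ cellFrontier n i, ¬ g z) :
    ∃ g' : Y → Prop, (∀ z ∈ (skeletonGraph Y).vertexSet, g' z ↔ g z) ∧
      CellwiseConstant L (n + 1) g' := by
  classical
  let g' : Y → Prop := fun z =>
    if ∃ i : cell (univ : Set Y) n, z ∈ openCell n i
    then ∃ i : cell (univ : Set Y) n, z ∈ openCell n i ∧ ∃ w ∈ cellFrontier n i, g w else g z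
  have hlow : ∀ {m : ℕ} (_ : m < n) {j : cell (univ : Set Y) m} {z : Y}, z ∈ openCell m j →
      (g' z ↔ g z) := by
    intro m hm j z hz
    have : ¬ ∃ i : cell (univ : Set Y) n, z ∈ openCell n i := by
      rintro ⟨i, hi⟩
      have := congrArg Sigma.fst (eq_of_mem_openCell hi hz)
      simp at this
      omega
    simp only [g', if_neg this]
  have hlow' : ∀ {m : ℕ} (_ : m < n) {j : cell (univ : Set Y) m} {z : Y}, z ∈ closedCell m j →
      (g' z ↔ g z) := by
    intro m hm j z hz
    rcases mem_closedCell_iff.1 hz with hz | hz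
    · obtain ⟨k, hk, l, hl⟩ := exists_mem_openCell_of_mem_cellFrontier hz
      exact hlow (hk.trans hm) hl
    · exact hlow hm hz
  have hfront : ∀ {i : cell (univ : Set Y) n} {z : Y}, z ∈ cellFrontier n i → (g' z ↔ g z) := by
    intro i z hz
    obtain ⟨k, hk, l, hl⟩ := exists_mem_openCell_of_mem_cellFrontier hz
    exact hlow hk hl
  have hopen : ∀ {i : cell (univ : Set Y) n} {z : Y}, z ∈ openCell n i →
      (g' z ↔ ∃ w ∈ cellFrontier n i, g w) := by
    intro i z hz
    have : ∃ i : cell (univ : Set Y) n, z ∈ openCell n i := ⟨i, hz⟩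
    simp only [g', if_pos this]
    constructor
    · rintro ⟨j, hj, hw⟩
      obtain rfl : j = i := by simpa using eq_of_mem_openCell hj hz
      exact hw
    · exact fun hw => ⟨i, hz, hw⟩
  refine ⟨g', fun z hz => ?_, fun m hm i hi => ?_⟩
  · obtain ⟨i, hi⟩ := openCell_zero_of_mem_vertexSet hz
    exact hlow (Nat.pos_of_ne_zero hn) (j := i) (by rw [hi]; rfl)
  · rcases Nat.lt_succ_iff_lt_or_eq.1 hm with hm | rfl
    · refine (h m hm i hi).imp (fun h z hz => (hlow' hm hz).2 (h z hz))
        (fun h z hz hz' => h z hz ((hlow' hm hz).1 hz'))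
    · rcases hfr i hi with hg | hg
      · refine Or.inl fun z hz => ?_
        rcases mem_closedCell_iff.1 hz with hz | hz
        · exact (hfront hz).2 (hg z hz)
        · obtain ⟨w, hw⟩ := RelCWComplex.nonempty_cellFrontier hn i
          exact (hopen hz).2 ⟨w, hw, hg w hw⟩
      · refine Or.inr fun z hz hz' => ?_
        rcases mem_closedCell_iff.1 hz with hz | hz
        · exact hg z hz ((hfront hz).1 hz')
        · obtain ⟨w, hw, hgw⟩ := (hopen hz).1 hz'
          exact hg w hw hgw

/-- Vertices of a connected subcomplex are joined by an edge path in it. -/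
theorem reflTransGen_edgeRel_of_isPreconnected [T2Space Y] (hfin : LocallyFiniteCW Y)
    (hdim : ∀ n, 2 < n → IsEmpty (cell (univ : Set Y) n)) (L : Subcomplex (univ : Set Y))
    (hL : IsPreconnected (L : Set Y)) {x y : Y} (hx : x ∈ (skeletonGraph Y).vertexSet)
    (hy : y ∈ (skeletonGraph Y).vertexSet) (hxL : x ∈ (L : Set Y)) (hyL : y ∈ (L : Set Y)) :
    Relation.ReflTransGen (EdgeRel (L : Set Y)) x y := by
  -- Reachability from `x` is extended from vertices to all of `L`: over edges because their ends
  -- are adjacent, over 2-cells because their frontiers are connected. It is then constant on the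
  -- connected set `L`.
  let g₁ : Y → Prop := fun z => Relation.ReflTransGen (EdgeRel (L : Set Y)) x z
  have h₁ : CellwiseConstant L 1 g₁ := by
    intro m hm i hi
    obtain rfl : m = 0 := by omega
    rw [RelCWComplex.closedCell_zero_eq_singleton]
    simp only [mem_singleton_iff, forall_eq]
    exact em _
  obtain ⟨g₂, hg₂, h₂⟩ := h₁.extend one_ne_zero (fun e he => by
    obtain ⟨a, b, hab⟩ := exists_isLink e
    have hE : EdgeRel (L : Set Y) a b := ⟨e, hab, L.closedCell_subset_of_mem he⟩
    rw [isLink_iff.1 hab]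
    by_cases ha : g₁ a
    · left
      rintro z (rfl | rfl)
      exacts [ha, ha.tail hE]
    · right
      rintro z (rfl | rfl)
      exacts [ha, fun hb => ha (hb.tail hE.symm)])
  obtain ⟨g₃, hg₃, h₃⟩ := h₂.extend two_ne_zero (fun i hi => by
    refine h₂.preconnected hfin (isPreconnected_cellFrontier le_rfl i) fun z hz => ?_
    obtain ⟨m, hm, j, hj⟩ := exists_mem_openCell_of_mem_cellFrontier hz
    exact ⟨m, hm, j, Subcomplex.mem_I_of_mem L hj (L.cellFrontier_subset_of_mem hi hz),
      RelCWComplex.openCell_subset_closedCell _ _ hj⟩)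
  have hx₃ : g₃ x := (hg₃ x hx).2 ((hg₂ x hx).2 .refl)
  rcases h₃.preconnected hfin hL (fun z hz => by
    obtain ⟨m, j, hj⟩ := exists_mem_openCell z
    refine ⟨m, ?_, j, Subcomplex.mem_I_of_mem L hj hz,
      RelCWComplex.openCell_subset_closedCell _ _ hj⟩
    by_contra hm
    exact (hdim m (by omega)).elim j) with h | h
  · exact (hg₂ y hy).1 ((hg₃ y hy).1 (h y hyL))
  · exact absurd hx₃ (h x hxL)

end Connectivity

end Cells

end JEnd

namespace JEnd

/-! ### Edge paths, rays and ends in terms of the adjacency relation -/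

section CayleyBridge

variable {G : Type*} [Group G] {A : Set G}

/-- Adjacency in the Cayley graph. -/
def CayleyRel (A : Set G) (x y : G) : Prop := ∃ e, (cayleyGraph A).IsLink e x y

theorem CayleyRel.symm ⦃x y : G⦄ (h : CayleyRel A x y) : CayleyRel A y x :=
  let ⟨e, h⟩ := h; ⟨e, h.symm⟩

theorem cayleyRel_mul {g a : G} (ha : a ∈ A) : CayleyRel A g (g * a) :=
  ⟨(g, ⟨a, ha⟩), Or.inl ⟨rfl, rfl⟩⟩

theorem cayleyRel_cases {x y : G} (h : CayleyRel A x y) : ∃ a ∈ A, y = x * a ∨ x = y * a := by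
  obtain ⟨e, ⟨rfl, rfl⟩ | ⟨rfl, rfl⟩⟩ := h
  exacts [⟨e.2, e.2.2, Or.inl rfl⟩, ⟨e.2, e.2.2, Or.inr rfl⟩]

theorem isInvRel_cayleyRel : IsInvRel G (CayleyRel A) := by
  intro s x y h
  obtain ⟨a, ha, rfl | rfl⟩ := cayleyRel_cases h
  · simpa [mul_assoc] using cayleyRel_mul (g := s * x) ha
  · simpa [mul_assoc] using (cayleyRel_mul (g := s * y) ha).symm

/-- Translate the edge so that its base point becomes `1`; the two families of pairs account for the
two directions. -/
theorem isCofiniteRel_cayleyRel (hA : A.Finite) : IsCofiniteRel G (CayleyRel A) := by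
  refine ⟨(fun a => ((1 : G), a)) '' A ∪ (fun a => (a, (1 : G))) '' A,
    (hA.image _).union (hA.image _), fun x y h => ?_⟩
  obtain ⟨a, ha, rfl | rfl⟩ := cayleyRel_cases h
  · exact ⟨x, _, Or.inl ⟨a, ha, rfl⟩, by simp, by simp⟩
  · exact ⟨y, _, Or.inr ⟨a, ha, rfl⟩, by simp, by simp⟩

theorem reflTransGen_cayleyRel (hA : Subgroup.closure A = ⊤) (x y : G) :
    Relation.ReflTransGen (CayleyRel A) x y := by
  have : Std.Symm (CayleyRel A) := ⟨fun _ _ h => h.symm⟩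
  have hone : ∀ x : G, Relation.ReflTransGen (CayleyRel A) 1 x := by
    intro x
    have hx : x ∈ Subgroup.closure A := by rw [hA]; trivial
    induction hx using Subgroup.closure_induction with
    | mem x hx => exact .single (by simpa using cayleyRel_mul (g := 1) hx)
    | one => exact .refl
    | mul x y _ _ hx hy =>
      have := isInvRel_cayleyRel.reflTransGen x hy
      exact hx.trans (by simpa using this)
    | inv x _ hx =>
      have := isInvRel_cayleyRel.reflTransGen x⁻¹ hx
      simp only [smul_eq_mul, mul_one, inv_mul_cancel] at this
      exact Relation.ReflTransGen.stdSymm.symm _ _ this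
  exact (Relation.ReflTransGen.stdSymm.symm _ _ (hone x)).trans (hone y)

theorem connOff_of_isEdgePath {F : Set G} {x y : G} {p : List ((G × A) × G)}
    (hp : IsEdgePath (cayleyGraph A) x p y) (hx : x ∉ F) (hF : ∀ d ∈ p, d.2 ∉ F) :
    ConnOff (CayleyRel A) F x y := by
  induction p generalizing x with
  | nil => obtain rfl : x = y := hp; exact ⟨hx, .refl⟩
  | cons d p ih =>
    have hd := hF d (by simp)
    exact (ConnOff.single ⟨d.1, hp.1⟩ hx hd).trans
      (ih hp.2 hd fun d' hd' => hF d' (by simp [hd']))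

theorem ConnOff.exists_isEdgePath {F : Set G} {x y : G} (h : ConnOff (CayleyRel A) F x y) :
    ∃ p, IsEdgePath (cayleyGraph A) x p y ∧ ∀ d ∈ p, d.2 ∉ F := by
  obtain ⟨-, h⟩ := h
  induction h using Relation.ReflTransGen.head_induction_on with
  | refl => exact ⟨[], rfl, by simp⟩
  | @head a c h _ ih =>
    obtain ⟨p, hp, hF⟩ := ih
    obtain ⟨⟨e, he⟩, -, hc⟩ := h
    exact ⟨(e, c) :: p, ⟨he, hp⟩, by
      intro d hd
      rcases List.mem_cons.1 hd with rfl | hd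
      exacts [hc, hF d hd]⟩

theorem CayleyRay.isProperRay (q : CayleyRay A) : IsProperRay (CayleyRel A) q.1.vert :=
  ⟨fun k => ⟨_, q.1.link k⟩, q.2⟩

theorem IsProperRay.exists_cayleyRay {f : ℕ → G} (h : IsProperRay (CayleyRel A) f) :
    ∃ q : CayleyRay A, q.1.vert = f := by
  choose e he using h.adj
  exact ⟨⟨⟨f, e, he⟩, h.finite⟩, rfl⟩

theorem CayleyRay.equiv_iff {q r : CayleyRay A} :
    q.Equiv r ↔ SeqEquiv (CayleyRel A) q.1.vert r.1.vert := by
  constructor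
  · intro h F hF
    obtain ⟨i, j, p, hp, hi, hd⟩ := h F hF
    exact ⟨i, j, connOff_of_isEdgePath hp hi hd⟩
  · intro h F hF
    obtain ⟨i, j, hij⟩ := h F hF
    obtain ⟨p, hp, hd⟩ := hij.exists_isEdgePath
    exact ⟨i, j, p, hp, hij.1, hd⟩

theorem CayleyRay.mk_eq_iff {q r : CayleyRay A} :
    (Quot.mk _ q : CayleyEnds A) = Quot.mk _ r ↔
      SeqEquiv (CayleyRel A) q.1.vert r.1.vert := by
  rw [← CayleyRay.equiv_iff]
  refine Equivalence.quot_mk_eq_iff ⟨fun q => ?_, fun {q r} h => ?_, fun {q r s} h h' => ?_⟩ _ _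
  · exact equiv_iff.2 (.refl q.isProperRay.isCoarseRay)
  · exact equiv_iff.2 ((equiv_iff.1 h).symm CayleyRel.symm)
  · exact equiv_iff.2 ((equiv_iff.1 h).trans CayleyRel.symm r.isProperRay.isCoarseRay
      (equiv_iff.1 h'))

end CayleyBridge

section ComplexBridge

open RelCWComplex (cell openCell closedCell cellFrontier)

variable {Y : Type*} [TopologicalSpace Y] [CWComplex (univ : Set Y)]

theorem IsEdgePath.connOff {A F : Set Y} {x y : Y} {p : List (cell (univ : Set Y) 1 × Y)}
    (hp : IsEdgePath (skeletonGraph Y) x p y) (hx : x ∉ F)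
    (hF : ∀ d ∈ p, closedCell 1 d.1 ⊆ A \ F) : ConnOff (EdgeRel A) F x y := by
  induction p generalizing x with
  | nil => obtain rfl : x = y := hp; exact ⟨hx, .refl⟩
  | cons d p ih =>
    have hd := hF d (by simp)
    have hd2 : d.2 ∉ F := (hd (right_mem_closedCell hp.1)).2
    exact (ConnOff.single ⟨d.1, hp.1, hd.trans sdiff_subset⟩ hx hd2).trans
      (ih hp.2 hd2 fun d' hd' => hF d' (by simp [hd']))

theorem joinedInByEdges_of_reflTransGen {A : Set Y} {x y : Y} (hx : x ∈ A)
    (h : Relation.ReflTransGen (EdgeRel A) x y) : JoinedInByEdges A x y := by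
  suffices ∃ p, IsEdgePath (skeletonGraph Y) x p y ∧ ∀ d ∈ p, closedCell 1 d.1 ⊆ A by
    obtain ⟨p, hp, hd⟩ := this
    exact ⟨p, hp, hx, hd⟩
  clear hx
  induction h using Relation.ReflTransGen.head_induction_on with
  | refl => exact ⟨[], rfl, by simp⟩
  | @head a c h _ ih =>
    obtain ⟨p, hp, hF⟩ := ih
    obtain ⟨e, he, heA⟩ := h
    exact ⟨(e, c) :: p, ⟨he, hp⟩, by
      intro d hd
      rcases List.mem_cons.1 hd with rfl | hd
      exacts [heA, hF d hd]⟩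

/-- An edge that meets `F` has both ends in a finite set, so avoiding that set keeps whole edges off
`F`. The vertices in `F` itself are added for the empty path. -/
theorem exists_finite_joinedInByEdges (hfin : LocallyFiniteCW Y) {F : Set Y} (hF : IsCompact F) :
    ∃ F' : Set Y, F'.Finite ∧ ∀ (A : Set Y) x y, x ∈ A → x ∈ (skeletonGraph Y).vertexSet →
      ConnOff (EdgeRel A) F' x y → JoinedInByEdges (A \ F) x y := by
  refine ⟨_, (finite_vertices_inter_compact hfin hF).union
    (finite_endpoints_inter_compact hfin hF), fun A x y hxA hx h => ?_⟩
  obtain ⟨hxF, h⟩ := h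
  refine joinedInByEdges_of_reflTransGen ⟨hxA, fun hF => hxF (Or.inl ⟨hx, hF⟩)⟩ ?_
  refine h.lift id ?_
  rintro a b ⟨⟨e, he, heA⟩, ha, -⟩
  refine ⟨e, he, fun z hz => ⟨heA hz, fun hzF => ha (Or.inr ⟨e, ?_, z, hz, hzF⟩)⟩⟩
  rw [isLink_iff.1 he]
  simp

variable {A : Set Y}

theorem ProperRayIn.isProperRay (r : ProperRayIn A) : IsProperRay (EdgeRel A) r.1.vert := by
  refine ⟨fun k => ⟨_, r.1.link k, r.2.1 k⟩, fun v => ?_⟩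
  refine (r.2.2 {v} isCompact_singleton).subset ?_
  rintro k rfl
  exact ⟨_, left_mem_closedCell (r.1.link k), rfl⟩

theorem IsProperRay.exists_properRayIn (hfin : LocallyFiniteCW Y) {f : ℕ → Y}
    (h : IsProperRay (EdgeRel A) f) : ∃ r : ProperRayIn A, r.1.vert = f := by
  choose e he heA using h.adj
  refine ⟨⟨⟨f, e, he⟩, heA, fun F hF => ?_⟩, rfl⟩
  refine (h.finite_preimage (finite_endpoints_inter_compact hfin hF)).subset fun k hk => ?_
  refine ⟨e k, ?_, hk⟩
  rw [isLink_iff.1 (he k)]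
  simp

theorem ProperRayIn.equiv_iff (hfin : LocallyFiniteCW Y) {r s : ProperRayIn A} :
    r.Equiv s ↔ SeqEquiv (EdgeRel A) r.1.vert s.1.vert := by
  constructor
  · intro h F hF
    obtain ⟨i, j, p, hp, hi, hd⟩ := h F hF.isCompact
    exact ⟨i, j, hp.connOff hi.2 hd⟩
  · intro h F hF
    obtain ⟨F', hF', hc⟩ := exists_finite_joinedInByEdges hfin hF
    obtain ⟨i, j, hij⟩ := h F' hF'
    exact ⟨i, j, hc A _ _ (r.isProperRay.adj i).left_mem (r.1.link i).left_mem hij⟩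

theorem ProperRayIn.toEnd_eq_iff (hfin : LocallyFiniteCW Y) {r s : ProperRayIn A} :
    r.toEnd = s.toEnd ↔ SeqEquiv (EdgeRel A) r.1.vert s.1.vert := by
  rw [← ProperRayIn.equiv_iff hfin]
  refine Equivalence.quot_mk_eq_iff ⟨fun q => ?_, fun {q r} h => ?_, fun {q r s} h h' => ?_⟩ _ _
  · exact (equiv_iff hfin).2 (.refl q.isProperRay.isCoarseRay)
  · exact (equiv_iff hfin).2 (((equiv_iff hfin).1 h).symm EdgeRel.symm)
  · exact (equiv_iff hfin).2 (((equiv_iff hfin).1 h).trans EdgeRel.symm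
      r.isProperRay.isCoarseRay ((equiv_iff hfin).1 h'))

/-- A ray in `A`, as a ray in a larger set. -/
def ProperRayIn.incl {A B : Set Y} (h : A ⊆ B) (r : ProperRayIn A) : ProperRayIn B :=
  ⟨r.1, fun k => (r.2.1 k).trans h, r.2.2⟩

theorem EdgeDistLE.mono {n k : ℕ} (hnk : n ≤ k) {x y : Y} (h : EdgeDistLE n x y) :
    EdgeDistLE k x y :=
  let ⟨p, hp, hn⟩ := h; ⟨p, hp, hn.trans hnk⟩

theorem exists_edgeDistLE_of_reflTransGen {x y : Y} (h : Relation.ReflTransGen (EdgeRel A) x y) :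
    ∃ n, EdgeDistLE n x y := by
  induction h using Relation.ReflTransGen.head_induction_on with
  | refl => exact ⟨0, [], rfl, by simp⟩
  | @head a c h _ ih =>
    obtain ⟨n, p, hp, hn⟩ := ih
    obtain ⟨e, he, -⟩ := h
    exact ⟨n + 1, (e, c) :: p, ⟨he, hp⟩, by simpa using hn⟩

theorem IsEdgePath.reflTransGen {x y : Y} {p : List (cell (univ : Set Y) 1 × Y)}
    (hp : IsEdgePath (skeletonGraph Y) x p y) (hA : ∀ d ∈ p, closedCell 1 d.1 ⊆ A) :
    Relation.ReflTransGen (EdgeRel A) x y :=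
  (hp.connOff (F := ∅) (notMem_empty x) (by simpa using hA)).2.lift id fun _ _ h => h.1

theorem IsEdgePath.reflTransGen_of_mem {x y : Y} {p : List (cell (univ : Set Y) 1 × Y)}
    (hp : IsEdgePath (skeletonGraph Y) x p y) (hA : ∀ d ∈ p, closedCell 1 d.1 ⊆ A) {d}
    (hd : d ∈ p) {v : Y} (hv : v ∈ cellFrontier 1 d.1) :
    Relation.ReflTransGen (EdgeRel A) x v := by
  induction p generalizing x with
  | nil => simp at hd
  | cons d' p ih =>
    rcases List.mem_cons.1 hd with rfl | hd'
    · rw [isLink_iff.1 hp.1] at hv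
      rcases hv with rfl | rfl
      exacts [.refl, .single ⟨d.1, hp.1, hA _ hd⟩]
    · exact .head ⟨d'.1, hp.1, hA _ (by simp)⟩
        (ih hp.2 (fun d h => hA d (by simp [h])) hd')

theorem IsEdgePath.mem_endpoint {x y : Y} {p : List (cell (univ : Set Y) 1 × Y)}
    (hp : IsEdgePath (skeletonGraph Y) x p y) : y = x ∨ ∃ d ∈ p, y = d.2 := by
  induction p generalizing x with
  | nil => exact Or.inl hp.symm
  | cons d p ih =>
    rcases ih hp.2 with rfl | ⟨d', hd', rfl⟩
    · exact Or.inr ⟨d, by simp, rfl⟩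
    · exact Or.inr ⟨d', by simp [hd'], rfl⟩

theorem IsEdgePath.mem_vertexSet {x y : Y} {p : List (cell (univ : Set Y) 1 × Y)}
    (hp : IsEdgePath (skeletonGraph Y) x p y) {d} (hd : d ∈ p) :
    d.2 ∈ (skeletonGraph Y).vertexSet := by
  induction p generalizing x with
  | nil => simp at hd
  | cons d' p ih =>
    rcases List.mem_cons.1 hd with rfl | hd'
    exacts [hp.1.right_mem, ih hp.2 hd']

end ComplexBridge

end JEnd

namespace JEnd

/-! ### Cellular covering actions -/

section CellularAction

open RelCWComplex (cell openCell closedCell cellFrontier Subcomplex)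

variable {Y : Type*} {J : Type*} [Group J] [MulAction J Y]

theorem mem_orbitSet {K : Set Y} {z : Y} : z ∈ orbitSet J K ↔ ∃ g : J, g⁻¹ • z ∈ K := by
  simp [orbitSet, mem_smul_set_iff_inv_smul_mem]

theorem smul_mem_orbitSet {K : Set Y} (g : J) {z : Y} :
    g • z ∈ orbitSet J K ↔ z ∈ orbitSet J K := by
  simp only [mem_orbitSet]
  constructor
  · rintro ⟨h, hz⟩
    exact ⟨g⁻¹ * h, by simpa [mul_smul] using hz⟩
  · rintro ⟨h, hz⟩
    exact ⟨g * h, by simpa [mul_smul] using hz⟩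

theorem subset_orbitSet (K : Set Y) : K ⊆ orbitSet J K := fun z hz => mem_orbitSet.2 ⟨1, by simpa⟩

theorem smul_subset_orbitSet (g : J) (K : Set Y) : g • K ⊆ orbitSet J K :=
  subset_iUnion (fun g : J => g • K) g

theorem smul_mem_of_stabilizer {U : Set Y} (s : MulAction.stabilizer J U) {z : Y} (hz : z ∈ U) :
    s • z ∈ U := by
  have h : (s : J) • U = U := s.2
  have h' : (s : J) • z ∈ (s : J) • U := smul_mem_smul_set hz
  rwa [h] at h'

variable [TopologicalSpace Y]

/-! ### Components of the complement of `J · C` -/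

theorem IsJUnboundedComponent.notMem {C U : Set Y} (hU : IsJUnboundedComponent J C U) {z : Y}
    (hz : z ∈ U) : z ∉ orbitSet J C := by
  obtain ⟨⟨x, hx, rfl⟩, -⟩ := hU
  exact connectedComponentIn_subset _ _ hz

theorem IsJUnboundedComponent.subset_of_isPreconnected {C U : Set Y}
    (hU : IsJUnboundedComponent J C U) {P : Set Y} (hP : IsPreconnected P) {z : Y} (hzP : z ∈ P)
    (hzU : z ∈ U) (hPC : ∀ w ∈ P, w ∉ orbitSet J C) : P ⊆ U := by
  obtain ⟨⟨x, hx, rfl⟩, -⟩ := hU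
  rw [connectedComponentIn_eq hzU]
  exact hP.subset_connectedComponentIn hzP hPC

/-- `g` preserves the complement of `J·C` and so permutes its components; two components with a
common point coincide. -/
theorem IsJUnboundedComponent.smul_eq [ContinuousConstSMul J Y] {C U : Set Y}
    (hU : IsJUnboundedComponent J C U) {g : J} {z : Y} (hz : z ∈ U) (hgz : g • z ∈ U) :
    g • U = U := by
  obtain ⟨⟨x, hx, rfl⟩, -⟩ := hU
  have hzC : z ∈ (orbitSet J C)ᶜ := connectedComponentIn_subset _ _ hz
  have h := (Homeomorph.smul g).image_connectedComponentIn hzC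
  have himg : (Homeomorph.smul g : Y ≃ₜ Y) '' (orbitSet J C)ᶜ = (orbitSet J C)ᶜ := by
    ext w
    constructor
    · rintro ⟨v, hv, rfl⟩
      exact fun hw => hv ((smul_mem_orbitSet g).1 hw)
    · exact fun hw => ⟨g⁻¹ • w, fun h => hw ((smul_mem_orbitSet g⁻¹).1 h), by simp⟩
  rw [himg, ← connectedComponentIn_eq hz] at h
  refine Eq.trans h ?_
  exact (connectedComponentIn_eq hgz).symm

variable [CWComplex (univ : Set Y)]

theorem IsCellularCoveringAction.smul_cancel (hact : IsCellularCoveringAction J Y)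
    {g h : J} {y : Y} (e : g • y = h • y) : g = h :=
  have := hact.covering.isCancelSMul
  IsCancelSMul.right_cancel _ _ y e

theorem IsJUnboundedComponent.mem_stabilizer (hact : IsCellularCoveringAction J Y)
    {C U : Set Y} (hU : IsJUnboundedComponent J C U) {g : J} {z : Y}
    (hz : z ∈ U) (hgz : g • z ∈ U) : g ∈ MulAction.stabilizer J U :=
  have := hact.covering.toContinuousConstSMul
  hU.smul_eq hz hgz

/-- The translates in `U` of a set meeting `U` are permuted transitively by the stabilizer. -/
theorem IsJUnboundedComponent.exists_smul_eq (hact : IsCellularCoveringAction J Y)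
    {C U : Set Y} (hU : IsJUnboundedComponent J C U)
    {ι : Type*} (K : ι → Set Y) (hK : ∀ i, (K i).Nonempty) :
    ∃ γ : ι → J, ∀ i (g : J), g • K i ⊆ U → γ i • K i ⊆ U ∧
      ∃ s : MulAction.stabilizer J U, (s : J) * γ i = g := by
  have : ∀ i, ∃ γ : J, ∀ g : J, g • K i ⊆ U → γ • K i ⊆ U ∧
      ∃ s : MulAction.stabilizer J U, (s : J) * γ = g := by
    intro i
    by_cases h : ∃ γ : J, γ • K i ⊆ U
    · obtain ⟨γ, hγ⟩ := h
      obtain ⟨z, hz⟩ := hK i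
      refine ⟨γ, fun g hg => ⟨hγ, ⟨g * γ⁻¹, hU.mem_stabilizer hact (z := γ • z)
        (hγ (smul_mem_smul_set hz)) ?_⟩, by simp⟩⟩
      rw [mul_smul, inv_smul_smul]
      exact hg (smul_mem_smul_set hz)
    · exact ⟨1, fun g hg => absurd ⟨g, hg⟩ h⟩
  exact ⟨fun i => (this i).choose, fun i => (this i).choose_spec⟩

variable [T2Space Y]

theorem IsCellularCoveringAction.exists_smul_cell (hact : IsCellularCoveringAction J Y)
    (g : J) (n : ℕ) (i : cell (univ : Set Y) n) :
    ∃ j : cell (univ : Set Y) n, openCell n j = g • openCell n i ∧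
      closedCell n j = g • closedCell n i ∧ cellFrontier n j = g • cellFrontier n i := by
  have := hact.covering.toContinuousConstSMul
  obtain ⟨j, hj⟩ := hact.cells g n i
  have hc : closedCell n j = g • closedCell n i := by
    rw [← RelCWComplex.closure_openCell_eq_closedCell, ← hj, closure_smul,
      RelCWComplex.closure_openCell_eq_closedCell]
  exact ⟨j, hj.symm, hc, by rw [cellFrontier_eq_diff, cellFrontier_eq_diff, hc, ← hj,
    smul_set_sdiff]⟩

theorem IsCellularCoveringAction.exists_smul_isLink (hact : IsCellularCoveringAction J Y)
    (g : J) {e : cell (univ : Set Y) 1} {x y : Y}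
    (h : (skeletonGraph Y).IsLink e x y) : ∃ e', (skeletonGraph Y).IsLink e' (g • x) (g • y) ∧
      closedCell 1 e' = g • closedCell 1 e := by
  obtain ⟨e', -, h2, h3⟩ := hact.exists_smul_cell g 1 e
  refine ⟨e', ?_, h2⟩
  rw [isLink_iff, h3, isLink_iff.1 h, ← image_smul, image_pair]

theorem IsCellularCoveringAction.smul_mem_vertexSet (hact : IsCellularCoveringAction J Y)
    (g : J) {x : Y}
    (h : x ∈ (skeletonGraph Y).vertexSet) : g • x ∈ (skeletonGraph Y).vertexSet := by
  obtain ⟨i, hi⟩ := h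
  obtain ⟨j, -, h2, -⟩ := hact.exists_smul_cell g 0 i
  exact ⟨j, by rw [h2, hi, smul_set_singleton]⟩

theorem IsCellularCoveringAction.edgeRel_smul (hact : IsCellularCoveringAction J Y)
    (g : J) {A : Set Y} {x y : Y}
    (h : EdgeRel A x y) : EdgeRel (g • A) (g • x) (g • y) := by
  obtain ⟨e, he, heA⟩ := h
  obtain ⟨e', he', h'⟩ := hact.exists_smul_isLink g he
  exact ⟨e', he', h' ▸ smul_set_mono heA⟩

theorem IsCellularCoveringAction.reflTransGen_smul (hact : IsCellularCoveringAction J Y)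
    (g : J) {A : Set Y} {x y : Y}
    (h : Relation.ReflTransGen (EdgeRel A) x y) :
    Relation.ReflTransGen (EdgeRel (g • A)) (g • x) (g • y) :=
  h.lift (g • ·) fun _ _ h => hact.edgeRel_smul g h

theorem IsCellularCoveringAction.edgeDistLE_smul (hact : IsCellularCoveringAction J Y)
    (g : J) {n : ℕ} {x y : Y}
    (h : EdgeDistLE n x y) : EdgeDistLE n (g • x) (g • y) := by
  obtain ⟨p, hp, hn⟩ := h
  induction p generalizing x n with
  | nil => obtain rfl : x = y := hp; exact ⟨[], rfl, by simp⟩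
  | cons d p ih =>
    obtain ⟨e', he', -⟩ := hact.exists_smul_isLink g hp.1
    rw [List.length_cons] at hn
    obtain ⟨q, hq, hqn⟩ := ih (n := n - 1) hp.2 (by omega)
    exact ⟨(e', g • d.2) :: q, ⟨he', hq⟩, by rw [List.length_cons]; omega⟩

/-- A subcomplex contains the closure of every open cell that it meets, and the same then holds for
the union of its translates. -/
theorem IsCellularCoveringAction.closedCell_subset_orbitSet (hact : IsCellularCoveringAction J Y)
    {C : Set Y}
    (hC : IsFiniteSubcomplex C) {n : ℕ} {i : cell (univ : Set Y) n} {z : Y} (hz : z ∈ openCell n i)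
    (hzC : z ∈ orbitSet J C) : closedCell n i ⊆ orbitSet J C := by
  obtain ⟨L, rfl, -⟩ := hC
  obtain ⟨g, hg⟩ := mem_orbitSet.1 hzC
  obtain ⟨j, h1, h2, -⟩ := hact.exists_smul_cell g⁻¹ n i
  have hj : j ∈ L.I n := Subcomplex.mem_I_of_mem L (by rw [h1]; exact smul_mem_smul_set hz) hg
  intro w hw
  refine mem_orbitSet.2 ⟨g, L.closedCell_subset_of_mem hj ?_⟩
  rw [h2]
  exact smul_mem_smul_set hw

theorem IsFiniteSubcomplex.isCompact {C : Set Y} (hC : IsFiniteSubcomplex C) :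
    IsCompact C := by
  obtain ⟨L, rfl, hL⟩ := hC
  have : (L : Set Y) = ⋃ c : Σ n, L.I n, closedCell c.1 (c.2 : cell (univ : Set Y) c.1) := by
    rw [← CWComplex.Subcomplex.union_closedCell L, iUnion_sigma]
  rw [this]
  exact isCompact_iUnion fun _ => RelCWComplex.isCompact_closedCell

variable {C U : Set Y}

theorem isInvRel_edgeRel (hact : IsCellularCoveringAction J Y) (U E : Set Y) :
    IsInvRel (MulAction.stabilizer J U) (EdgeRel (U ∩ orbitSet J E)) := by
  intro s x y h
  refine EdgeRel.mono ?_ _ _ (hact.edgeRel_smul (s : J) h)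
  rintro _ ⟨z, ⟨hz, hzE⟩, rfl⟩
  exact ⟨smul_mem_of_stabilizer s hz, (smul_mem_orbitSet _).2 hzE⟩

/-- Each edge involved is a translate of one of the finitely many edges meeting `E`, and `S` is
transitive on the translates of a given edge that lie in `U`. -/
theorem IsJUnboundedComponent.isCofiniteRel_edgeRel (hact : IsCellularCoveringAction J Y)
    (hfin : LocallyFiniteCW Y) (hU : IsJUnboundedComponent J C U) {E : Set Y} (hE : IsCompact E) :
    IsCofiniteRel (MulAction.stabilizer J U) (EdgeRel (U ∩ orbitSet J E)) := by
  obtain ⟨γ, hγ⟩ := hU.exists_smul_eq hact (fun e : cell (univ : Set Y) 1 => closedCell 1 e)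
    fun e => RelCWComplex.closedCell_nonempty 1 e
  refine ⟨⋃ e ∈ {e : cell (univ : Set Y) 1 | (closedCell 1 e ∩ E).Nonempty},
    (fun p : Y × Y => (γ e • p.1, γ e • p.2)) '' (cellFrontier 1 e ×ˢ cellFrontier 1 e), ?_, ?_⟩
  · refine (finite_edges_inter_compact hfin hE).biUnion fun e _ => Finite.image _ ?_
    obtain ⟨a, b, h⟩ := exists_isLink e
    rw [isLink_iff.1 h]
    exact (toFinite _).prod (toFinite _)
  · rintro x y ⟨e, he, heA⟩
    obtain ⟨z, hz⟩ := RelCWComplex.openCell_nonempty 1 e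
    have hze := RelCWComplex.openCell_subset_closedCell 1 e hz
    obtain ⟨g, hg⟩ := mem_orbitSet.1 (heA hze).2
    obtain ⟨e', -, h2, h3⟩ := hact.exists_smul_cell g⁻¹ 1 e
    have hge : g • closedCell 1 e' = closedCell 1 e := by rw [h2, smul_inv_smul]
    obtain ⟨-, s, hs⟩ := hγ e' g (hge.trans_subset (heA.trans inter_subset_left))
    have hmem : ∀ w ∈ cellFrontier 1 e, g⁻¹ • w ∈ cellFrontier 1 e' := by
      intro w hw
      rw [h3]
      exact smul_mem_smul_set hw
    have heq : ∀ w : Y, w = s • (γ e' • (g⁻¹ • w)) := by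
      intro w
      rw [Subgroup.smul_def, ← mul_smul, hs, smul_inv_smul]
    refine ⟨s, (γ e' • (g⁻¹ • x), γ e' • (g⁻¹ • y)), mem_biUnion (x := e') ?_ ?_, heq x, heq y⟩
    · exact ⟨g⁻¹ • z, by rw [h2]; exact smul_mem_smul_set hze, hg⟩
    · refine ⟨(g⁻¹ • x, g⁻¹ • y), ⟨hmem x ?_, hmem y ?_⟩, rfl⟩ <;> simp [isLink_iff.1 he]

/-- Without vertices `U` would be `J`-bounded. By induction on the dimension, each open cell meeting
`U` has a closure that meets `J·C` or a translate of the compact set found for lower dimensions. -/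
theorem IsJUnboundedComponent.exists_vertex (hact : IsCellularCoveringAction J Y)
    (hfin : LocallyFiniteCW Y) (hdim : ∀ n, 2 < n → IsEmpty (cell (univ : Set Y) n))
    (hC : IsFiniteSubcomplex C) (hU : IsJUnboundedComponent J C U) :
    ∃ u ∈ (skeletonGraph Y).vertexSet, u ∈ U := by
  by_contra! hno
  have key : ∀ n : ℕ, ∃ K : Set Y, IsCompact K ∧
      ∀ z ∈ U, ∀ m < n, ∀ i : cell (univ : Set Y) m, z ∈ openCell m i → z ∈ orbitSet J K := by
    intro n
    induction n with
    | zero => exact ⟨∅, isCompact_empty, by simp⟩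
    | succ n ih =>
      obtain ⟨K, hK, hKU⟩ := ih
      let N := ⋃ c ∈ {c : Σ n, cell (univ : Set Y) n | (closedCell c.1 c.2 ∩ (C ∪ K)).Nonempty},
        closedCell c.1 c.2
      have hN : ∀ i : cell (univ : Set Y) n, ∀ w ∈ closedCell n i, w ∈ orbitSet J (C ∪ K) →
          ∀ z ∈ openCell n i, z ∈ orbitSet J N := by
        intro i w hw hwC z hz
        obtain ⟨g, hg⟩ := mem_orbitSet.1 hwC
        obtain ⟨j, -, h2, -⟩ := hact.exists_smul_cell g⁻¹ n i
        refine mem_orbitSet.2 ⟨g, mem_biUnion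
          (show (⟨n, j⟩ : Σ n, cell (univ : Set Y) n) ∈ _ from ⟨g⁻¹ • w, ?_, hg⟩) ?_⟩
        · rw [h2]; exact smul_mem_smul_set hw
        · dsimp only
          rw [h2]
          exact smul_mem_smul_set (RelCWComplex.openCell_subset_closedCell _ _ hz)
      refine ⟨K ∪ N, hK.union (isCompact_closedCells_inter hfin (hC.isCompact.union hK)), ?_⟩
      intro z hz m hm i hi
      rcases Nat.lt_succ_iff_lt_or_eq.1 hm with hm | rfl
      · exact orbitSet_mono J subset_union_left (hKU z hz m hm i hi)
      · refine orbitSet_mono J subset_union_right ?_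
        by_cases hcl : ∃ w ∈ closedCell m i, w ∈ orbitSet J C
        · obtain ⟨w, hw, hwC⟩ := hcl
          exact hN i w hw (orbitSet_mono J subset_union_left hwC) z hi
        · push Not at hcl
          -- A closed cell that misses `J·C` is connected and stays in `U`; its frontier is nonempty
          -- and lies in lower cells, where the induction hypothesis applies.
          have hsub : closedCell m i ⊆ U := hU.subset_of_isPreconnected
            (isPreconnected_closedCell m i) (RelCWComplex.openCell_subset_closedCell _ _ hi) hz hcl
          have hm0 : m ≠ 0 := by
            rintro rfl
            exact hno z (mem_vertexSet_of_mem_openCell hi) hz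
          obtain ⟨w, hw⟩ := RelCWComplex.nonempty_cellFrontier hm0 i
          have hwc := RelCWComplex.cellFrontier_subset_closedCell _ _ hw
          obtain ⟨k, hk, l, hl⟩ := exists_mem_openCell_of_mem_cellFrontier hw
          exact hN i w hwc (orbitSet_mono J subset_union_right (hKU w (hsub hwc) k hk l hl)) z hi
  obtain ⟨K, hK, hKU⟩ := key 3
  refine hU.2 ⟨K, hK, fun z hz => ?_⟩
  obtain ⟨n, i, hi⟩ := exists_mem_openCell z
  refine hKU z hz n ?_ i hi
  by_contra hn
  exact (hdim n (by omega)).elim i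

/-- A vertex of `U` with a neighbour in `J · C`. -/
def IsFrontierVertex (J : Type*) [Group J] [MulAction J Y] (C U : Set Y) (w : Y) : Prop :=
  w ∈ U ∧ ∃ e w', (skeletonGraph Y).IsLink e w w' ∧ w' ∈ orbitSet J C

/-- Up to `J`, such a vertex is an end of one of the finitely many edges meeting `C`; passing to
representatives inside `U` replaces `J` by `S`. -/
theorem IsJUnboundedComponent.exists_finite_frontierVertices (hact : IsCellularCoveringAction J Y)
    (hfin : LocallyFiniteCW Y) (hC : IsFiniteSubcomplex C) (hU : IsJUnboundedComponent J C U) :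
    ∃ W : Set Y, W.Finite ∧ (∀ w ∈ W, w ∈ U ∧ w ∈ (skeletonGraph Y).vertexSet) ∧
      ∀ w, IsFrontierVertex J C U w → ∃ s : MulAction.stabilizer J U, ∃ w₀ ∈ W, w = s • w₀ := by
  obtain ⟨γ, hγ⟩ := hU.exists_smul_eq hact (fun x : Y => {x}) fun x => singleton_nonempty x
  simp only [smul_set_singleton, singleton_subset_iff] at hγ
  have hN := finite_endpoints_inter_compact hfin hC.isCompact
  refine ⟨((fun x => γ x • x) '' _) ∩ U, (hN.image _).inter_of_left _, ?_, ?_⟩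
  · rintro _ ⟨⟨x, ⟨e, hx, -⟩, rfl⟩, hU'⟩
    exact ⟨hU', hact.smul_mem_vertexSet _ (mem_vertexSet_of_mem_cellFrontier hx)⟩
  · rintro w ⟨hw, e, w', he, hw'⟩
    obtain ⟨g, hg⟩ := mem_orbitSet.1 hw'
    obtain ⟨e', he', -⟩ := hact.exists_smul_isLink g⁻¹ he
    obtain ⟨h1, s, hs⟩ := hγ (g⁻¹ • w) g (by rwa [smul_inv_smul])
    refine ⟨s, γ (g⁻¹ • w) • g⁻¹ • w, ⟨⟨g⁻¹ • w, ⟨e', ?_, g⁻¹ • w', ?_, hg⟩, rfl⟩, h1⟩, ?_⟩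
    · simp [isLink_iff.1 he']
    · exact right_mem_closedCell he'
    · rw [Subgroup.smul_def, ← mul_smul, hs, smul_inv_smul]

/-- An edge path in `B` that starts in `U` stays in `U` or reaches a frontier vertex in `U`. -/
theorem IsJUnboundedComponent.reflTransGen_inter (hact : IsCellularCoveringAction J Y)
    (hC : IsFiniteSubcomplex C) (hU : IsJUnboundedComponent J C U) {B : Set Y} {x y : Y}
    (hx : x ∈ U) (h : Relation.ReflTransGen (EdgeRel B) x y) :
    (y ∈ U ∧ Relation.ReflTransGen (EdgeRel (U ∩ B)) x y) ∨
      ∃ w, IsFrontierVertex J C U w ∧ Relation.ReflTransGen (EdgeRel (U ∩ B)) x w := by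
  induction h with
  | refl => exact Or.inl ⟨hx, .refl⟩
  | @tail b c _ hbc ih =>
    rcases ih with ⟨hb, ih⟩ | ih
    · obtain ⟨e, he, heB⟩ := hbc
      by_cases heU : closedCell 1 e ⊆ U
      · exact Or.inl ⟨heU (right_mem_closedCell he),
          ih.tail ⟨e, he, subset_inter heU heB⟩⟩
      · refine Or.inr ⟨b, ⟨hb, e, c, he, ?_⟩, ih⟩
        -- If `c` also missed `J·C`, so would the whole closed edge, and by connectedness it would
        -- lie in `U`.
        by_contra hc
        refine heU (hU.subset_of_isPreconnected (isPreconnected_closedCell 1 e)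
          (left_mem_closedCell he) hb fun w hw hwC => ?_)
        rcases mem_closedCell_iff.1 hw with hw | hw
        · rw [isLink_iff.1 he] at hw
          rcases hw with rfl | rfl
          exacts [hU.notMem hb hwC, hc hwC]
        · exact hU.notMem hb (hact.closedCell_subset_orbitSet hC hw hwC (left_mem_closedCell he))
    · exact Or.inr ih

end CellularAction

end JEnd

namespace JEnd

/-! ### Choice of `D₀`, distance bounds and the equivariant map to the group -/

section Core

open RelCWComplex (cell openCell closedCell cellFrontier Subcomplex)

variable {Y : Type*} [TopologicalSpace Y] [CWComplex (univ : Set Y)]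

/-- Finitely many vertices of `U` lie in a compact union of closed edges and a vertex `u` of `U`, all
of whose vertices are joined to `u` in it. -/
theorem EdgePathConnected.exists_isCompact {U : Set Y} (hU : EdgePathConnected U) {u : Y}
    (hu : u ∈ (skeletonGraph Y).vertexSet) (huU : u ∈ U) {X : Set Y} (hX : X.Finite)
    (hXU : ∀ x ∈ X, x ∈ U ∧ x ∈ (skeletonGraph Y).vertexSet) :
    ∃ D : Set Y, IsCompact D ∧ D ⊆ U ∧ u ∈ D ∧
      (∀ x ∈ X, Relation.ReflTransGen (EdgeRel D) u x) ∧
      ∀ (e : cell (univ : Set Y) 1) (z : Y), z ∈ openCell 1 e → z ∈ D →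
        ∀ v ∈ cellFrontier 1 e, Relation.ReflTransGen (EdgeRel D) u v := by
  have hpath : ∀ x : Y, ∃ p, x ∈ X → IsEdgePath (skeletonGraph Y) u p x ∧
      ∀ d ∈ p, closedCell 1 d.1 ⊆ U := by
    intro x
    by_cases hx : x ∈ X
    · obtain ⟨p, hp, -, hd⟩ := hU u hu x (hXU x hx).2 huU (hXU x hx).1
      exact ⟨p, fun _ => ⟨hp, hd⟩⟩
    · exact ⟨[], fun h => absurd h hx⟩
  choose p hp using hpath
  let D : Set Y := {u} ∪ ⋃ x ∈ X, ⋃ d ∈ {d | d ∈ p x}, closedCell 1 d.1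
  have hpD : ∀ x ∈ X, ∀ d ∈ p x, closedCell 1 d.1 ⊆ D := by
    intro x hx d hd z hz
    exact Or.inr (mem_biUnion hx (mem_biUnion (show d ∈ {d | d ∈ p x} from hd) hz))
  refine ⟨D, ?_, ?_, Or.inl rfl, fun x hx => (hp x hx).1.reflTransGen (hpD x hx), ?_⟩
  · exact isCompact_singleton.union (hX.isCompact_biUnion fun x _ =>
      (List.finite_toSet (p x)).isCompact_biUnion fun _ _ => RelCWComplex.isCompact_closedCell)
  · rintro z (rfl | hz)
    · exact huU
    · simp only [mem_iUnion] at hz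
      obtain ⟨x, hx, d, hd, hz⟩ := hz
      exact (hp x hx).2 d hd hz
  · rintro e z hz (rfl | hzD) v hv
    · exact absurd (eq_zero_of_mem_openCell hu hz) one_ne_zero
    · simp only [mem_iUnion] at hzD
      obtain ⟨x, hx, d, hd, hzd⟩ := hzD
      obtain rfl := eq_of_mem_openCell_closedCell_one hz hzd
      exact (hp x hx).1.reflTransGen_of_mem (hpD x hx) hd hv

theorem exists_edgeDistLE_forall {P : Set (Y × Y)} (hP : P.Finite)
    (h : ∀ p ∈ P, ∃ n, EdgeDistLE n p.1 p.2) : ∃ N, ∀ p ∈ P, EdgeDistLE N p.1 p.2 := by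
  choose! n hn using h
  obtain ⟨N, hN⟩ := (hP.image n).bddAbove
  exact ⟨N, fun p hp => (hn p hp).mono (hN (mem_image_of_mem n hp))⟩

theorem exists_edgeDistLE [T2Space Y] [PreconnectedSpace Y] (hfin : LocallyFiniteCW Y)
    (hdim : ∀ n, 2 < n → IsEmpty (cell (univ : Set Y) n)) {x y : Y}
    (hx : x ∈ (skeletonGraph Y).vertexSet) (hy : y ∈ (skeletonGraph Y).vertexSet) :
    ∃ n, EdgeDistLE n x y := by
  -- All of `Y`, regarded as a subcomplex.
  let L : Subcomplex (univ : Set Y) :=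
    { carrier := univ
      I := fun _ => univ
      closed' := isClosed_univ
      union' := by
        simpa only [empty_union, iUnion_coe_set, mem_univ, iUnion_true] using
          CWComplex.iUnion_openCell_eq_complex (C := (univ : Set Y)) }
  exact exists_edgeDistLE_of_reflTransGen (reflTransGen_edgeRel_of_isPreconnected hfin hdim L
    isPreconnected_univ hx hy (mem_univ x) (mem_univ y))

/-- For a free action there is an equivariant map to the group. -/
theorem exists_equivariant_to_group {S W : Type*} [Group S] [MulAction S W]
    (hW : ∀ (s t : S) (w : W), s • w = t • w → s = t) :
    ∃ ψ : W → S, ∀ (s : S) (w : W), ψ (s • w) = s * ψ w := by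
  let r : W → W := fun w => (Quotient.mk (MulAction.orbitRel S W) w).out
  have hr : ∀ w, ∃ s : S, s • r w = w := fun w =>
    (MulAction.orbitRel S W).symm (Quotient.exact (Quotient.out_eq (Quotient.mk _ w)))
  choose ψ hψ using hr
  refine ⟨ψ, fun s w => hW _ _ (r w) ?_⟩
  have : r (s • w) = r w :=
    congrArg Quotient.out (Quotient.sound (s := MulAction.orbitRel S W) ⟨s, rfl⟩)
  rw [mul_smul, hψ w, ← this, hψ]

end Core

/-! ### Vertices of the image of a Cayley ray -/

section CayleyMapVertices

variable {Y : Type*} [TopologicalSpace Y] [CWComplex (univ : Set Y)]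
  {J : Type*} [Group J] [MulAction J Y] {S : Subgroup J} {A : Set S} {b : Y}

theorem CayleyMap.exists_of_mem_path (m : CayleyMap S A b) {s : S} {a : A} {d}
    (hd : d ∈ m.path s a) : ∃ d' ∈ m.path 1 a, d.2 = s • d'.2 := by
  have h := m.equivariant s 1 a
  rw [mul_one] at h
  have hmem := List.mem_map_of_mem (f := fun d => (RelCWComplex.closedCell 1 d.1, d.2)) hd
  rw [h, List.mem_map] at hmem
  obtain ⟨d', hd', he⟩ := hmem
  exact ⟨d', hd', (congrArg Prod.snd he).symm⟩

/-- When the ray traverses the edge `(g, a)` backwards, its `k`-th vertex is `g * a`, the far end of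
the edge path; this is why `mem_endpoint` is needed. -/
theorem CayleyMap.smul_vert_mem (m : CayleyMap S A b) (q : CayleyRay A) (k : ℕ) :
    q.1.vert k • b ∈ m.rayVertices q := by
  rcases q.1.link k with ⟨h, -⟩ | ⟨h, -⟩
  · exact ⟨k, Or.inl (by rw [h])⟩
  · refine ⟨k, ?_⟩
    rw [h]
    exact (m.isEdgePath _ _).mem_endpoint

theorem CayleyMap.exists_finite_rayVertices (m : CayleyMap S A b) (hA : A.Finite)
    (hb : b ∈ (skeletonGraph Y).vertexSet) :
    ∃ Z : Set Y, Z.Finite ∧ Z ⊆ (skeletonGraph Y).vertexSet ∧ ∀ q : CayleyRay A,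
      ∀ x ∈ m.rayVertices q, ∃ k, ∃ z ∈ Z, x = q.1.vert k • z := by
  have := hA.to_subtype
  refine ⟨{b} ∪ ⋃ a : A, Prod.snd '' {d | d ∈ m.path 1 a}, ?_, ?_, ?_⟩
  · exact (finite_singleton b).union
      (finite_iUnion fun a => (List.finite_toSet (m.path 1 a)).image _)
  · rintro x (rfl | hx)
    · exact hb
    · simp only [mem_iUnion] at hx
      obtain ⟨a, d, hd, rfl⟩ := hx
      exact (m.isEdgePath 1 a).mem_vertexSet hd
  · rintro q x ⟨k, hk⟩
    have hvert : ∃ j, (q.1.edge k).1 = q.1.vert j := by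
      rcases q.1.link k with ⟨h, -⟩ | ⟨-, h⟩
      exacts [⟨k, h.symm⟩, ⟨k + 1, h.symm⟩]
    obtain ⟨j, hj⟩ := hvert
    rcases hk with rfl | ⟨d, hd, rfl⟩
    · exact ⟨j, b, Or.inl rfl, by rw [hj]⟩
    · obtain ⟨d', hd', he⟩ := m.exists_of_mem_path hd
      exact ⟨j, d'.2, Or.inr (mem_iUnion.2 ⟨_, d', hd', rfl⟩), by rw [he, hj]⟩

end CayleyMapVertices

end JEnd

/-! ### The main theorem -/

theorem lemma7p4 {Y : Type*} [TopologicalSpace Y] [T2Space Y] [CWComplex (univ : Set Y)]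
    [SimplyConnectedSpace Y]
    (hfin : JEnd.LocallyFiniteCW Y)
    (hdim : ∀ n, 2 < n → IsEmpty (RelCWComplex.cell (univ : Set Y) n))
    (hend : JEnd.OneEnded Y)
    {J : Type*} [Group J] [Infinite J] [Group.FG J] [MulAction J Y]
    (hact : JEnd.IsCellularCoveringAction J Y)
    (b : Y) (hb : b ∈ (JEnd.skeletonGraph Y).vertexSet)
    (C U : Set Y) (hC : JEnd.IsFiniteSubcomplex C) (hU : JEnd.IsJUnboundedComponent J C U)
    (hUconn : JEnd.EdgePathConnected U)
    (A : Set (MulAction.stabilizer J U)) (hA : A.Finite) (hAgen : Subgroup.closure A = ⊤)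
    (m : JEnd.CayleyMap (MulAction.stabilizer J U) A b) :
    ∃ D : Set Y, IsCompact D ∧ C ⊆ D ∧
      ∃ (M : JEnd.CayleyEnds A ≃ JEnd.JBoundedEnds J U D) (I : ℕ),
        ∀ (E : Set Y) (_ : IsCompact E) (hDE : D ⊆ E),
          let ι : JEnd.JBoundedEnds J U D → JEnd.JBoundedEnds J U E :=
            JEnd.RayEnds.incl (inter_subset_inter_right U (JEnd.orbitSet_mono J hDE))
          Function.Injective ι ∧
          (JEnd.IsFiniteSubcomplex E → IsConnected E → Function.Surjective ι) ∧
          ∀ (q : JEnd.CayleyRay A) (t : JEnd.ProperRayIn (U ∩ JEnd.orbitSet J E)),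
            ι (M (Quot.mk _ q)) = t.toEnd →
              ∃ t' : JEnd.ProperRayIn (U ∩ JEnd.orbitSet J E),
                t'.toEnd = t.toEnd ∧ m.Tracks I q t' := by
  have hfreeY : ∀ (s t : MulAction.stabilizer J U) (w : Y), s • w = t • w → s = t :=
    fun s t w h => Subtype.ext (hact.smul_cancel h)
  have hfreeS : ∀ s t w : MulAction.stabilizer J U, s • w = t • w → s = t :=
    fun s t w h => mul_right_cancel h
  obtain ⟨u, hu, huU⟩ := hU.exists_vertex hact hfin hdim hC
  obtain ⟨W, hW, hWU, hWfr⟩ := hU.exists_finite_frontierVertices hact hfin hC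
  -- The points `a • u` will make `S·u` connected; the set `W` is needed only for surjectivity.
  obtain ⟨D₀, hD₀, hD₀U, huD₀, hD₀X, hD₀e⟩ := hUconn.exists_isCompact hu huU
    (X := (fun a : MulAction.stabilizer J U => a • u) '' A ∪ W) ((hA.image _).union hW) (by
      rintro x (⟨a, -, rfl⟩ | hx)
      · exact ⟨JEnd.smul_mem_of_stabilizer a huU, hact.smul_mem_vertexSet (a : J) hu⟩
      · exact hWU x hx)
  have hsub₀ : D₀ ⊆ U ∩ JEnd.orbitSet J (C ∪ D₀) := fun z hz =>
    ⟨hD₀U hz, JEnd.subset_orbitSet _ (Or.inr hz)⟩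
  set T := JEnd.EdgeRel (U ∩ JEnd.orbitSet J (C ∪ D₀))
  have hTinv : JEnd.IsInvRel (MulAction.stabilizer J U) T := JEnd.isInvRel_edgeRel hact U _
  have h₀ : ∀ {x y}, Relation.ReflTransGen (JEnd.EdgeRel D₀) x y → Relation.ReflTransGen T x y :=
    fun h => h.lift id (JEnd.EdgeRel.mono hsub₀)
  have hTsymm : ∀ {x y}, Relation.ReflTransGen T x y → Relation.ReflTransGen T y x := by
    have : Std.Symm T := ⟨JEnd.EdgeRel.symm⟩
    exact fun {x y} h => Relation.ReflTransGen.stdSymm.symm _ _ h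
  have hcay : ∀ s t : MulAction.stabilizer J U, JEnd.CayleyRel A s t →
      Relation.ReflTransGen T (s • u) (t • u) := by
    intro s t h
    obtain ⟨a, ha, rfl | rfl⟩ := JEnd.cayleyRel_cases h
    · rw [mul_smul]
      exact hTinv.reflTransGen s (h₀ (hD₀X _ (Or.inl ⟨a, ha, rfl⟩)))
    · rw [mul_smul]
      exact hTsymm (hTinv.reflTransGen t (h₀ (hD₀X _ (Or.inl ⟨a, ha, rfl⟩))))
  have hconn : ∀ s t : MulAction.stabilizer J U, Relation.ReflTransGen T (s • u) (t • u) := by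
    intro s t
    induction JEnd.reflTransGen_cayleyRel hAgen s t with
    | refl => exact .refl
    | tail _ h ih => exact ih.trans (hcay _ _ h)
  obtain ⟨ψ, hψ⟩ := JEnd.exists_equivariant_to_group hfreeY
  -- An interior point of the edge lies in some `g • D₀`, since `U` misses `J·C`. As `D₀ ⊆ U`, this
  -- forces `g ∈ S`, so `x` is joined to `g • u`, hence to any point of `S·u`.
  have hψT : ∀ x y, T x y → Relation.ReflTransGen T (ψ x • u) x := by
    rintro x y ⟨e, he, heD⟩
    obtain ⟨z, hz⟩ := RelCWComplex.openCell_nonempty 1 e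
    have hzD := heD (RelCWComplex.openCell_subset_closedCell 1 e hz)
    obtain ⟨g, hg⟩ := JEnd.mem_orbitSet.1 hzD.2
    have hg₀ : g⁻¹ • z ∈ D₀ := hg.resolve_left fun hgC =>
      hU.notMem hzD.1 (JEnd.mem_orbitSet.2 ⟨g, hgC⟩)
    have hgS : g ∈ MulAction.stabilizer J U :=
      hU.mem_stabilizer hact (hD₀U hg₀) (by rw [smul_inv_smul]; exact hzD.1)
    obtain ⟨e', h1, -, h3⟩ := hact.exists_smul_cell g⁻¹ 1 e
    have hpath := hD₀e e' (g⁻¹ • z) (by rw [h1]; exact smul_mem_smul_set hz) hg₀ (g⁻¹ • x) (by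
      rw [h3, JEnd.isLink_iff.1 he]
      exact smul_mem_smul_set (by simp))
    have hpath' := hTinv.reflTransGen ⟨g, hgS⟩ (h₀ hpath)
    rw [Subgroup.smul_def _ (g⁻¹ • x), smul_inv_smul] at hpath'
    exact (hconn _ _).trans hpath'
  have hcof : ∀ E : Set Y, IsCompact E → JEnd.IsCofiniteRel (MulAction.stabilizer J U)
      (JEnd.EdgeRel (U ∩ JEnd.orbitSet J E)) := fun E hE => hU.isCofiniteRel_edgeRel hact hfin hE
  have hDc : IsCompact (C ∪ D₀) := hC.isCompact.union hD₀
  have hφeq : ∀ s t : MulAction.stabilizer J U, (s • t) • u = s • t • u :=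
    fun s t => by rw [smul_eq_mul, mul_smul]
  have hπeq : ∀ (s : MulAction.stabilizer J U) (y : Y), ψ (s • y) • u = s • ψ y • u :=
    fun s y => by rw [hψ, mul_smul]
  -- These facts make `φ : s ↦ s • u`, `ψ` and `π : y ↦ ψ y • u` act on ends, with `ψ ∘ φ` and `π`
  -- equivalent to the identity. Maps into `S` need no connectivity check, because the Cayley graph
  -- is connected.
  have cφ := JEnd.coarselyConn_of_equivariant hfreeY (JEnd.isCofiniteRel_cayleyRel hA) hTinv
    hφeq hφeq hcay
  have cψ := JEnd.coarselyConn_of_equivariant hfreeS (hcof _ hDc)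
    (JEnd.isInvRel_cayleyRel (A := A)) hψ hψ fun _ _ _ => JEnd.reflTransGen_cayleyRel hAgen _ _
  have cψφ := JEnd.coarselyConn_of_equivariant hfreeS (JEnd.isCofiniteRel_cayleyRel hA)
    (JEnd.isInvRel_cayleyRel (A := A)) (α := fun s => ψ (s • u)) (β := id)
    (fun s t => by rw [hφeq, hψ]; rfl) (fun _ _ => rfl)
    fun _ _ _ => JEnd.reflTransGen_cayleyRel hAgen _ _
  have cψφ' := JEnd.coarselyConn_of_equivariant hfreeS (JEnd.isCofiniteRel_cayleyRel hA)
    (JEnd.isInvRel_cayleyRel (A := A)) (α := fun s => ψ (s • u)) (β := fun s => ψ (s • u))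
    (fun s t => by rw [hφeq, hψ]; rfl) (fun s t => by rw [hφeq, hψ]; rfl)
    fun _ _ _ => JEnd.reflTransGen_cayleyRel hAgen _ _
  have cπ : ∀ E : Set Y, IsCompact E → JEnd.CoarselyConn
      (JEnd.EdgeRel (U ∩ JEnd.orbitSet J E)) T (fun y => ψ y • u) fun y => ψ y • u := fun E hE =>
    JEnd.coarselyConn_of_equivariant hfreeY (hcof E hE) hTinv hπeq hπeq fun _ _ _ => hconn _ _
  have cπid := JEnd.coarselyConn_of_equivariant hfreeY (hcof _ hDc) hTinv
    (β := id) hπeq (fun _ _ => rfl) fun x y h => (hψT x y h).tail h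
  obtain ⟨B, hB, hφray⟩ := JEnd.exists_properRay_of_equivariant hfreeY
    (JEnd.isCofiniteRel_cayleyRel hA) hTinv JEnd.EdgeRel.symm hφeq hcay
  obtain ⟨_, _, hψray⟩ := JEnd.exists_properRay_of_equivariant hfreeS (hcof _ hDc)
    (JEnd.isInvRel_cayleyRel (A := A)) JEnd.CayleyRel.symm hψ
    fun _ _ _ => JEnd.reflTransGen_cayleyRel hAgen _ _
  have hτ : ∀ q : JEnd.CayleyRay A, ∃ t : JEnd.ProperRayIn (U ∩ JEnd.orbitSet J (C ∪ D₀)),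
      JEnd.SeqEquiv T t.1.vert ((fun s => s • u) ∘ q.1.vert) ∧
      (∀ k, ∃ n, t.1.vert n = q.1.vert k • u) ∧ ∀ n, ∃ k, ∃ s : MulAction.stabilizer J U,
        ∃ p ∈ B, q.1.vert k = s • p.1 ∧ t.1.vert n = s • p.2 := by
    intro q
    obtain ⟨f, hf, h1, h2, h3⟩ := hφray _ q.isProperRay
    obtain ⟨t, rfl⟩ := hf.exists_properRayIn hfin
    exact ⟨t, h1, h2, h3⟩
  choose τ hτequiv hτhit hτnear using hτ
  have hφcoarse : ∀ q : JEnd.CayleyRay A,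
      JEnd.IsCoarseRay T ((fun s => s • u) ∘ q.1.vert) := fun q => cφ.isCoarseRay q.isProperRay
  have hτiff : ∀ q r : JEnd.CayleyRay A, (τ q).toEnd = (τ r).toEnd ↔
      JEnd.SeqEquiv (JEnd.CayleyRel A) q.1.vert r.1.vert := by
    intro q r
    rw [JEnd.ProperRayIn.toEnd_eq_iff hfin]
    constructor
    · intro h
      -- Applying `ψ` to `τ q` recovers the end of `q`.
      have key : ∀ q, JEnd.SeqEquiv (JEnd.CayleyRel A) (ψ ∘ (τ q).1.vert) q.1.vert := fun q =>
        (cψ.map_seqEquiv (τ q).isProperRay.adj (hτequiv q)).trans JEnd.CayleyRel.symm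
          (cψφ'.isCoarseRay q.isProperRay) (cψφ.seqEquiv_comp q.isProperRay)
      have h' := cψ.map_seqEquiv (τ q).isProperRay.adj h
      exact (((key q).symm JEnd.CayleyRel.symm).trans JEnd.CayleyRel.symm
        (cψ.isCoarseRay (τ q).isProperRay) h').trans JEnd.CayleyRel.symm
        (cψ.isCoarseRay (τ r).isProperRay) (key r)
    · intro h
      have h' := cφ.map_seqEquiv q.isProperRay.adj h
      exact ((hτequiv q).trans JEnd.EdgeRel.symm (hφcoarse q) h').trans JEnd.EdgeRel.symm
        (hφcoarse r) ((hτequiv r).symm JEnd.EdgeRel.symm)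
  let Mf : JEnd.CayleyEnds A → JEnd.JBoundedEnds J U (C ∪ D₀) :=
    Quot.lift (fun q => (τ q).toEnd) fun q r h => (hτiff q r).2 (JEnd.CayleyRay.equiv_iff.1 h)
  have hMf : Function.Bijective Mf := by
    constructor
    · rintro ⟨q⟩ ⟨r⟩ h
      exact JEnd.CayleyRay.mk_eq_iff.2 ((hτiff q r).1 h)
    · rintro ⟨g⟩
      obtain ⟨f, hf, hfg, -⟩ := hψray _ g.isProperRay
      obtain ⟨q, rfl⟩ := hf.exists_cayleyRay
      -- `q` follows `ψ ∘ g`, so its image follows `π ∘ g`, which is equivalent to `g`.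
      refine ⟨Quot.mk _ q, (JEnd.ProperRayIn.toEnd_eq_iff hfin (r := τ q) (s := g)).2 ?_⟩
      have h1 := cφ.map_seqEquiv q.isProperRay.adj hfg
      exact ((hτequiv q).trans JEnd.EdgeRel.symm (hφcoarse q) h1).trans JEnd.EdgeRel.symm
        ((cπ _ hDc).isCoarseRay g.isProperRay) (cπid.seqEquiv_comp g.isProperRay)
  obtain ⟨Z, hZ, hZv, hZray⟩ := m.exists_finite_rayVertices hA hb
  obtain ⟨I₁, hI₁⟩ := JEnd.exists_edgeDistLE_forall (hZ.image fun z => (z, u)) (by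
    rintro _ ⟨z, hz, rfl⟩
    exact JEnd.exists_edgeDistLE hfin hdim (hZv hz) hu)
  -- What is known of `B` does not say that second components are vertices, so the bound is taken
  -- over those that are; the ones that occur along a ray all qualify.
  obtain ⟨I₂, hI₂⟩ := JEnd.exists_edgeDistLE_forall
    (P := (fun p : MulAction.stabilizer J U × Y => (p.2, p.1 • b)) ''
      (B ∩ {p | p.2 ∈ (JEnd.skeletonGraph Y).vertexSet})) ((hB.inter_of_left _).image _) (by
    rintro _ ⟨p, ⟨-, hp⟩, rfl⟩
    exact JEnd.exists_edgeDistLE hfin hdim hp (hact.smul_mem_vertexSet (p.1 : J) hb))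
  refine ⟨C ∪ D₀, hDc, subset_union_left, Equiv.ofBijective Mf hMf, max I₁ I₂, ?_⟩
  intro E hE hDE
  have hmono : U ∩ JEnd.orbitSet J (C ∪ D₀) ⊆ U ∩ JEnd.orbitSet J E :=
    inter_subset_inter_right U (JEnd.orbitSet_mono J hDE)
  have hTE := JEnd.EdgeRel.mono hmono
  refine ⟨?_, ?_, ?_⟩
  · rintro ⟨f⟩ ⟨g⟩ h
    have h' := (JEnd.ProperRayIn.toEnd_eq_iff hfin (r := f.incl hmono) (s := g.incl hmono)).1 h
    refine (JEnd.ProperRayIn.toEnd_eq_iff hfin (r := f) (s := g)).2 ?_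
    -- `π` pushes the equivalence from `U ∩ J·E` back into `U ∩ J·D`, where it does not change the
    -- end of a ray.
    have h1 := (cπ E hE).map_seqEquiv (f.incl hmono).isProperRay.adj h'
    exact (((cπid.seqEquiv_comp f.isProperRay).symm JEnd.EdgeRel.symm).trans JEnd.EdgeRel.symm
      ((cπ _ hDc).isCoarseRay f.isProperRay) h1).trans JEnd.EdgeRel.symm
      ((cπ _ hDc).isCoarseRay g.isProperRay) (cπid.seqEquiv_comp g.isProperRay)
  · rintro ⟨L, rfl, -⟩ hEconn ⟨g⟩
    have hψE : ∀ x y, JEnd.EdgeRel (U ∩ JEnd.orbitSet J (L : Set Y)) x y →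
        Relation.ReflTransGen (JEnd.EdgeRel (U ∩ JEnd.orbitSet J (L : Set Y))) (ψ x • u) x := by
      intro x y hxy
      have hxv := hxy.left_mem_vertexSet
      obtain ⟨hxU, hxE⟩ := hxy.left_mem
      have hsymm : Std.Symm (JEnd.EdgeRel (U ∩ JEnd.orbitSet J (L : Set Y))) :=
        ⟨JEnd.EdgeRel.symm⟩
      obtain ⟨g, hg⟩ := JEnd.mem_orbitSet.1 hxE
      have hpath := hact.reflTransGen_smul g
        (JEnd.reflTransGen_edgeRel_of_isPreconnected hfin hdim L hEconn.isPreconnected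
          (hact.smul_mem_vertexSet g⁻¹ hxv) hu hg (hDE (Or.inr huD₀)))
      rw [smul_inv_smul] at hpath
      have hpath' := hpath.lift id (JEnd.EdgeRel.mono (JEnd.smul_subset_orbitSet g (L : Set Y)))
      -- If the path stays in `U`, then `u` and `g • u` both lie in `U` and `g ∈ S`; otherwise the
      -- frontier vertex is `s • w₀` with `w₀` joined to `u` in `D₀`.
      rcases hU.reflTransGen_inter hact hC hxU hpath' with ⟨hgu, hp⟩ | ⟨w, hw, hp⟩
      · have h1 := hconn (ψ x) ⟨g, hU.mem_stabilizer hact huU hgu⟩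
        exact (h1.lift id hTE).trans (Relation.ReflTransGen.stdSymm.symm _ _ hp)
      · obtain ⟨s, w₀, hw₀, rfl⟩ := hWfr w hw
        have h1 := (hconn (ψ x) s).trans (hTinv.reflTransGen s (h₀ (hD₀X w₀ (Or.inr hw₀))))
        exact (h1.lift id hTE).trans (Relation.ReflTransGen.stdSymm.symm _ _ hp)
    have cE := JEnd.coarselyConn_of_equivariant hfreeY (hcof _ hE)
      (JEnd.isInvRel_edgeRel hact U (L : Set Y))
      (β := id) hπeq (fun _ _ => rfl) fun x y h => (hψE x y h).tail h
    obtain ⟨_, _, hπray⟩ := JEnd.exists_properRay_of_equivariant hfreeY (hcof _ hE)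
      hTinv JEnd.EdgeRel.symm hπeq fun _ _ _ => hconn _ _
    -- A proper ray in `U ∩ J·D` following `π ∘ g` is the preimage, since `cE` makes `π ∘ g`
    -- equivalent to `g` in `U ∩ J·E`.
    obtain ⟨f, hf, hfg, -⟩ := hπray _ g.isProperRay
    obtain ⟨r, rfl⟩ := hf.exists_properRayIn hfin
    refine ⟨r.toEnd, (JEnd.ProperRayIn.toEnd_eq_iff hfin (r := r.incl hmono) (s := g)).2 ?_⟩
    exact (hfg.mono hTE).trans JEnd.EdgeRel.symm (((cπ _ hE).isCoarseRay g.isProperRay).mono hTE)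
      (cE.seqEquiv_comp g.isProperRay)
  · intro q t ht
    refine ⟨(τ q).incl hmono, ht, fun x hx => ?_, fun n => ?_⟩
    -- `τ q` passes exactly through `q.1.vert k • u`, so only the distance from `z` to `u` counts.
    · obtain ⟨k, z, hz, rfl⟩ := hZray q x hx
      obtain ⟨n, hn⟩ := hτhit q k
      refine ⟨n, ?_⟩
      change JEnd.EdgeDistLE _ _ ((τ q).1.vert n)
      rw [hn]
      exact (hact.edgeDistLE_smul (q.1.vert k : J)
        (hI₁ (z, u) (mem_image_of_mem _ hz))).mono (le_max_left _ _)
    · obtain ⟨k, s, p, hp, h1, h2⟩ := hτnear q n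
      refine ⟨_, m.smul_vert_mem q k, ?_⟩
      change JEnd.EdgeDistLE _ ((τ q).1.vert n) _
      have hv : p.2 ∈ (JEnd.skeletonGraph Y).vertexSet := by
        have := hact.smul_mem_vertexSet (s⁻¹ : J) ((τ q).1.link n).left_mem
        rwa [h2, Subgroup.smul_def, inv_smul_smul] at this
      rw [h1, h2, smul_eq_mul, mul_smul]
      exact (hact.edgeDistLE_smul (s : J)
        (hI₂ _ (mem_image_of_mem _ ⟨hp, hv⟩))).mono (le_max_right _ _)
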